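/- **Notation.** $\mathbb N=\{1,2,\ldots\}$, $\mathbb N_0=\mathbb N\cup\{0\}$; $\lVert\cdot\rVert_1$ and $\lVert\cdot\rVert_\infty$ are the usual norms on $\mathbb R^n$. For $\mathbf d,\mathbf L\in\mathbb N$, $\mathbf l=(\mathbf l_0,\ldots,\mathbf l_{\mathbf L})\in\mathbb N^{\mathbf L+1}$ and $\theta\in\mathbb R^{\mathbf d}$ with $\mathbf d\ge\sum_{i=1}^{\mathbf L}\mathbf l_i(\mathbf l_{i-1}+1)$ let $\mathcal A_i\colon\mathbb R^{\mathbf l_{i-1}}\to\mathbb R^{\mathbf l_i}$, $i\in\{1,\ldots,\mathbf L\}$, be the affine map $x\mapsto W_ix+\beta_i$ whose $\mathbf l_i\times\mathbf l_{i-1}$ weight matrix $W_i$ (row by row) followed by its bias $\beta_i\in\mathbb R^{\mathbf l_i}$ are the coordinates of $\theta$ with indices $s_i+1,\ldots,s_i+\mathbf l_i(\mathbf l_{i-1}+1)$, where $s_i=\sum_{j=1}^{i-1}\mathbf l_j(\mathbf l_{j-1}+1)$. For $u<v$ let $\mathscr N^{\theta,\mathbf l}_{u,v}=\mathfrak C\circ\mathcal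 A_{\mathbf L}\circ\mathfrak R\circ\mathcal A_{\mathbf L-1}\circ\cdots\circ\mathfrak R\circ\mathcal A_1$ be the rectified clipped network, where $\mathfrak R$ acts componentwise by $x\mapsto\max\{x,0\}$ and $\mathfrak C$ componentwise by $x\mapsto\max\{u,\min\{x,v\}\}$. **Corollary.** Let $d,\mathbf d,\mathbf L,M,K,N\in\mathbb N$, $L,a,u\in\mathbb R$, $b\in(a,\infty)$, $v\in(u,\infty)$, $c\in[\max\{1,L,|a|,|b|,2|u|,2|v|\},\infty)$, $B\in[c,\infty)$, $\mathbf l=(\mathbf l_0,\ldots,\mathbf l_{\mathbf L})\in\mathbb N^{\mathbf L+1}$, $\mathbf N\subseteq\{0,1,\ldots,N\}$, and assume $0\in\mathbf N$, $\mathbf l_0=d$, $\mathbf l_{\mathbf L}=1$ and $\mathbf d\ge\sum_{i=1}^{\mathbf L}\mathbf l_i(\mathbf l_{i-1}+1)$. Let $(\Omega,\mathcal F,\mathbb P)$ be a probability space, let $X_j\colon\Omega\to[a,b]^d$ and $Y_j\colon\Omega\to[u,v]$, $j\in\mathbb N$, be functions such that $(X_j,Y_j)$, $j\in\{1,\ldots,M\}$,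 are i.i.d. random variables, and let $\mathcal E\colon[a,b]^d\to[u,v]$ satisfy $\mathcal E(X_1)=\mathbb E[Y_1|X_1]$ $\mathbb P$-a.s. and $|\mathcal E(x)-\mathcal E(y)|\le L\lVert x-y\rVert_1$ for all $x,y\in[a,b]^d$. Let $\Theta_{k,n}\colon\Omega\to\mathbb R^{\mathbf d}$, $k,n\in\mathbb N_0$, and $\mathbf k\colon\Omega\to(\mathbb N_0)^2$ be random variables, assume that $\Theta_{k,0}(\Omega)\subseteq[-B,B]^{\mathbf d}$ for all $k\in\mathbb N$, that $\Theta_{k,0}$, $k\in\{1,\ldots,K\}$, are i.i.d., and that $\Theta_{1,0}$ is uniformly distributed on $[-c,c]^{\mathbf d}$. Let $\mathcal R\colon\mathbb R^{\mathbf d}\times\Omega\to[0,\infty)$ satisfy for all $\theta\in\mathbb R^{\mathbf d}$, $\omega\in\Omega$ that $$\mathcal R(\theta,\omega)=\frac1M\Bigl[\sum_{j=1}^M|\mathscr N^{\theta,\mathbf l}_{u,v}(X_j(\omega))-Y_j(\omega)|^2\Bigr],\qquad \mathbf k(\omega)\in\operatorname*{argmin}_{(k,n)\in\{1,\ldots,K\}\times\mathbf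 N,\ \lVert\Theta_{k,n}(\omega)\rVert_\infty\le B}\mathcal R(\Theta_{k,n}(\omega),\omega).$$ Put $\mathbf m=\min(\{\mathbf L\}\cup\{\mathbf l_i\colon i\in\mathbb N\cap[0,\mathbf L)\})$ and $\lVert\mathbf l\rVert_\infty=\max_{0\le i\le\mathbf L}\mathbf l_i$. Then for all $p\in(0,\infty)$ the integrals below are integrals of integrable functions and $$\Bigl(\mathbb E\Bigl[\Bigl(\int_{[a,b]^d}|\mathscr N^{\Theta_{\mathbf k},\mathbf l}_{u,v}(x)-\mathcal E(x)|^2\,\mathbb P_{X_1}(\mathrm dx)\Bigr)^{p/2}\Bigr]\Bigr)^{1/p}$$ $$\le\frac{3dL(b-a)}{\mathbf m^{1/d}}+\frac{2[(v-u)\mathbf L(\lVert\mathbf l\rVert_\infty+1)^{\mathbf L}c^{\mathbf L+1}\max\{1,p/2\}]^{1/2}}{K^{[(2\mathbf L)^{-1}(\lVert\mathbf l\rVert_\infty+1)^{-2}]}}+\frac{3\max\{1,v-u\}(\lVert\mathbf l\rVert_\infty+1)[\mathbf L\max\{p,2\ln(3MBc)\}]^{1/2}}{M^{1/4}}$$ $$\le\frac{6dc^2}{\mathbf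 m^{1/d}}+\frac{2\mathbf L(\lVert\mathbf l\rVert_\infty+1)^{\mathbf L}c^{\mathbf L+1}\max\{1,p\}}{K^{[(2\mathbf L)^{-1}(\lVert\mathbf l\rVert_\infty+1)^{-2}]}}+\frac{5B^2\mathbf L(\lVert\mathbf l\rVert_\infty+1)\max\{p,\ln(eM)\}}{M^{1/4}}.$$ -/

import Mathlib

open MeasureTheory ProbabilityTheory

noncomputable section

/-- The cube `[a, b]^d` in `ℝ^d`. -/
abbrev Cube (d : ℕ) (a b : ℝ) : Set (Fin d → ℝ) :=
  Set.Icc (fun _ => a) (fun _ => b)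

/-- The coordinate of `θ ∈ ℝ^D` with zero-based index `i`. The default value is never read
when `D` is at least the number of parameters of the network at hand. -/
def paramAt {D : ℕ} (θ : Fin D → ℝ) (i : ℕ) : ℝ :=
  if h : i < D then θ ⟨i, h⟩ else 0

/-- The affine function `ℝ^n → ℝ^m` whose `m × n` weight matrix is stored row by row in the
coordinates `θ_{s+1}, …, θ_{s+mn}` and whose bias is stored in `θ_{s+mn+1}, …, θ_{s+mn+m}`
(one-based numbering). -/
def affineMapAt {D : ℕ} (θ : Fin D → ℝ) (s m n : ℕ) (x : Fin n → ℝ) : Fin m → ℝ :=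
  fun i => (∑ j : Fin n, paramAt θ (s + i * n + j) * x j) + paramAt θ (s + m * n + i)

/-- The number `∑_{i=1}^L l_i (l_{i-1} + 1)` of parameters of the architecture
`l = (l_0, …, l_L)`. -/
def numParams {L : ℕ} (l : Fin (L + 1) → ℕ) : ℕ :=
  ∑ j : Fin L, l j.succ * (l j.castSucc + 1)

/-- The number of parameters used by the layers that precede layer `i` (zero-based). -/
def layerOffset {L : ℕ} (l : Fin (L + 1) → ℕ) (i : Fin L) : ℕ :=
  ∑ j ∈ Finset.Iio i, l j.succ * (l j.castSucc + 1)

/-- The fully connected feedforward network with architecture `l = (l_0, …, l_L)`, parameter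
vector `θ` (read from offset `s` on) and activation functions `act 0, …, act (L - 1)`:
the composition `act (L-1) ∘ A_{L-1} ∘ ⋯ ∘ act 0 ∘ A_0` of activations and affine maps. -/
def neuralNet {D L : ℕ} (θ : Fin D → ℝ) (s : ℕ) (l : Fin (L + 1) → ℕ)
    (act : (i : Fin L) → (Fin (l i.succ) → ℝ) → (Fin (l i.succ) → ℝ)) :
    (Fin (l 0) → ℝ) → (Fin (l (Fin.last L)) → ℝ) :=
  Fin.induction (motive := fun i => (Fin (l 0) → ℝ) → (Fin (l i) → ℝ))
    (fun x => x)
    (fun i f x => act i (affineMapAt θ (s + layerOffset l i) (l i.succ) (l i.castSucc) (f x)))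
    (Fin.last L)

/-- The rectifier function. -/
def rectifier (x : ℝ) : ℝ := max x 0

/-- The clipping function with values in `[u, v]`. -/
def clipping (u v x : ℝ) : ℝ := max u (min x v)

/-- The rectified clipped network: componentwise rectifiers after each affine map except the
last one, and componentwise clipping to `[u, v]` after the last one. -/
def clippedNet {D L : ℕ} (θ : Fin D → ℝ) (l : Fin (L + 1) → ℕ) (u v : ℝ) :
    (Fin (l 0) → ℝ) → (Fin (l (Fin.last L)) → ℝ) :=
  neuralNet θ 0 l (fun i y k => if (i : ℕ) + 1 = L then clipping u v (y k) else rectifier (y k))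

/-- The rectified clipped network as a real-valued function on `ℝ^d` when `l_0 = d` and
`l_L = 1`. -/
def clippedNetReal {d D L : ℕ} (l : Fin (L + 1) → ℕ) (hin : l 0 = d)
    (hout : l (Fin.last L) = 1) (u v : ℝ) (θ : Fin D → ℝ) (x : Fin d → ℝ) : ℝ :=
  clippedNet θ l u v (fun i => x (Fin.cast hin i)) (Fin.cast hout.symm 0)

/-- The maximal layer size `‖l‖_∞ = max {l_0, …, l_L}`. -/
def maxWidth {L : ℕ} (l : Fin (L + 1) → ℕ) : ℕ := Finset.univ.sup l

/-- `min ({L} ∪ {l_i : i ∈ ℕ, 0 < i < L})`: the minimum of the depth and of the hidden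
layer sizes. -/
def minDepthWidth {L : ℕ} (l : Fin (L + 1) → ℕ) : ℕ :=
  sInf ({L} ∪ {m : ℕ | ∃ i : Fin (L + 1), 0 < (i : ℕ) ∧ (i : ℕ) < L ∧ l i = m})

end

noncomputable section

/-! The squared `L²` error of a network exceeds that of the best one for three reasons: the
architecture cannot represent `E` exactly, the random initializations miss a good parameter vector,
and minimization uses the empirical risk instead of the true one. By the bias-variance identity
`integral_sq_sub_regression`, the squared error of a network is its true risk minus the risk of `E`.
Fix a good parameter vector `ϑ`, and let `Z` be the selected one and `Θ k 0` the initialization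
closest to `ϑ`. Since `Z` minimizes the empirical risk among candidates that include `Θ k 0`, the
true risk of `Z` is at most that of `ϑ`, plus the empirical cost of moving from `ϑ` to `Θ k 0`, plus
twice the largest deviation of empirical from true risk over `[-B, B]^D`. The deviation bound is
uniform in the parameter, so nothing is needed about how `Z` depends on the data.

Approximation (`exists_clippedNetReal_near`): a Lipschitz function is close to the maximum of the
cones `f(xⱼ) - L ‖x - xⱼ‖₁` over a grid of points. A deep network computes this maximum by updating
a running maximum one cone per layer (`exists_maxNet`), so depth and width both limit the number of
cones.

Optimization (`eLpNorm_iInf_dist_le`): each uniform sample lies within `2cδ` of `ϑ` in the relevant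
`n` coordinates with probability at least `δ ^ n`. Independence makes the tail of the smallest
distance exponential, and the network is Lipschitz in its parameters (`abs_clippedNetReal_sub_le`).

Generalization (`exists_generalization_bound`): the parameter cube is replaced by a finite grid,
Hoeffding's lemma makes the deviation at each grid point sub-Gaussian, and a maximal inequality
controls all of them at once; Lipschitz continuity handles the points off the grid.

Finally `integral_rpow_le_of_error_decomposition` takes `L^q` norms with `q = max 1 (p / 2)` and
splits the square root over the three contributions. -/

/-! ### Size, Lipschitz dependence on the parameters, and continuity of the network -/

/-- The output of the first `i` layers of the rectified clipped network. -/
def layerState {D L : ℕ} (θ : Fin D → ℝ) (l : Fin (L + 1) → ℕ) (u v : ℝ) (i : Fin (L + 1)) :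
    (Fin (l 0) → ℝ) → (Fin (l i) → ℝ) :=
  Fin.induction (motive := fun i => (Fin (l 0) → ℝ) → (Fin (l i) → ℝ))
    (fun x => x)
    (fun i f x k => if (i : ℕ) + 1 = L
      then clipping u v (affineMapAt θ (0 + layerOffset l i) (l i.succ) (l i.castSucc) (f x) k)
      else rectifier (affineMapAt θ (0 + layerOffset l i) (l i.succ) (l i.castSucc) (f x) k)) i

theorem clippedNet_eq_layerState {D L : ℕ} (θ : Fin D → ℝ) (l : Fin (L + 1) → ℕ) (u v : ℝ) :
    clippedNet θ l u v = layerState θ l u v (Fin.last L) := rfl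

theorem layerState_zero {D L : ℕ} (θ : Fin D → ℝ) (l : Fin (L + 1) → ℕ) (u v : ℝ)
    (x : Fin (l 0) → ℝ) : layerState θ l u v 0 x = x := rfl

theorem layerState_succ {D L : ℕ} (θ : Fin D → ℝ) (l : Fin (L + 1) → ℕ) (u v : ℝ) (i : Fin L)
    (x : Fin (l 0) → ℝ) (k : Fin (l i.succ)) :
    layerState θ l u v i.succ x k = if (i : ℕ) + 1 = L
      then clipping u v (affineMapAt θ (layerOffset l i) (l i.succ) (l i.castSucc)
        (layerState θ l u v i.castSucc x) k)
      else rectifier (affineMapAt θ (layerOffset l i) (l i.succ) (l i.castSucc)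
        (layerState θ l u v i.castSucc x) k) := by
  rw [← Nat.zero_add (layerOffset l i)]
  rfl

theorem clipping_mem {u v : ℝ} (h : u ≤ v) (x : ℝ) : clipping u v x ∈ Set.Icc u v := by
  unfold clipping
  exact ⟨le_max_left _ _, max_le h (min_le_right _ _)⟩

theorem abs_clipping_sub_le (u v x y : ℝ) : |clipping u v x - clipping u v y| ≤ |x - y| := by
  unfold clipping
  refine (abs_max_sub_max_le_max _ _ _ _).trans ?_
  have := abs_min_sub_min_le_max x v y v
  simp only [sub_self, abs_zero] at this ⊢
  exact max_le (abs_nonneg _) (this.trans (max_le le_rfl (abs_nonneg _)))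

theorem abs_rectifier_sub_le (x y : ℝ) : |rectifier x - rectifier y| ≤ |x - y| := by
  unfold rectifier
  refine (abs_max_sub_max_le_max _ _ _ _).trans ?_
  simp

theorem abs_rectifier_le (x : ℝ) : |rectifier x| ≤ |x| := by
  simpa [rectifier] using abs_rectifier_sub_le x 0

theorem rectifier_nonneg (x : ℝ) : 0 ≤ rectifier x := le_max_right _ _

theorem rectifier_of_nonneg {x : ℝ} (h : 0 ≤ x) : rectifier x = x := max_eq_left h

theorem layerOffset_add_le {L : ℕ} (l : Fin (L + 1) → ℕ) (i : Fin L) :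
    layerOffset l i + l i.succ * (l i.castSucc + 1) ≤ numParams l := by
  unfold layerOffset numParams
  have h : i ∉ Finset.Iio i := by simp
  rw [add_comm, ← Finset.sum_insert (f := fun j : Fin L => l j.succ * (l j.castSucc + 1)) h]
  exact Finset.sum_le_sum_of_subset (Finset.subset_univ _)

theorem le_maxWidth {L : ℕ} (l : Fin (L + 1) → ℕ) (i : Fin (L + 1)) : l i ≤ maxWidth l :=
  Finset.le_sup (f := l) (Finset.mem_univ i)

theorem numParams_le {L : ℕ} (l : Fin (L + 1) → ℕ) :
    numParams l ≤ L * (maxWidth l * (maxWidth l + 1)) := by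
  unfold numParams
  calc ∑ j : Fin L, l j.succ * (l j.castSucc + 1)
      ≤ ∑ _j : Fin L, maxWidth l * (maxWidth l + 1) := by
        gcongr <;> apply le_maxWidth
    _ = _ := by simp

theorem weight_index_lt {m n : ℕ} (i : Fin m) (j : Fin n) (s : ℕ) :
    s + i * n + j < s + m * (n + 1) := by
  have h1 : (i : ℕ) * n + n ≤ m * n := by
    have := Nat.mul_le_mul_right n (Nat.succ_le_of_lt i.2)
    rwa [Nat.succ_mul] at this
  have := j.2
  have : m * (n + 1) = m * n + m := by ring
  omega

theorem bias_index_lt {m n : ℕ} (i : Fin m) (s : ℕ) :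
    s + m * n + i < s + m * (n + 1) := by
  have := i.2
  have : m * (n + 1) = m * n + m := by ring
  omega

theorem abs_paramAt_le {D : ℕ} {θ : Fin D → ℝ} {B : ℝ} (hB : 0 ≤ B) (h : ∀ i, |θ i| ≤ B) (i : ℕ) :
    |paramAt θ i| ≤ B := by
  unfold paramAt
  split_ifs
  · exact h _
  · simpa using hB

theorem abs_affineMapAt_le {D : ℕ} {θ : Fin D → ℝ} {B R : ℝ} (hB : 0 ≤ B)
    (h : ∀ i, |θ i| ≤ B) (hR : 1 ≤ R) {s m n W : ℕ} (hn : n ≤ W) {x : Fin n → ℝ}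
    (hx : ∀ j, |x j| ≤ R) (i : Fin m) :
    |affineMapAt θ s m n x i| ≤ B * (W + 1) * R := by
  unfold affineMapAt
  have hnW : (n : ℝ) ≤ W := by exact_mod_cast hn
  calc _ ≤ |∑ j : Fin n, paramAt θ (s + i * n + j) * x j| + |paramAt θ (s + m * n + i)| :=
        abs_add_le _ _
    _ ≤ (∑ j : Fin n, B * R) + B * R := by
        gcongr
        · refine (Finset.abs_sum_le_sum_abs _ _).trans (Finset.sum_le_sum fun j _ => ?_)
          rw [abs_mul]
          gcongr
          · exact abs_paramAt_le hB h _
          · exact hx j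
        · exact (abs_paramAt_le hB h _).trans (le_mul_of_one_le_right hB hR)
    _ = B * (n + 1) * R := by simp; ring
    _ ≤ _ := by gcongr

theorem abs_affineMapAt_sub_le {D : ℕ} {θ ϑ : Fin D → ℝ} {B R δ η : ℝ} (hB : 0 ≤ B)
    (h : ∀ i, |ϑ i| ≤ B) (hR : 1 ≤ R) (hδ : 0 ≤ δ) (hη : 0 ≤ η) {s m n W : ℕ} (hn : n ≤ W)
    (hclose : ∀ i < s + m * (n + 1), |paramAt θ i - paramAt ϑ i| ≤ δ) {x y : Fin n → ℝ}
    (hx : ∀ j, |x j| ≤ R) (hxy : ∀ j, |x j - y j| ≤ η) (i : Fin m) :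
    |affineMapAt θ s m n x i - affineMapAt ϑ s m n y i| ≤ δ * (W + 1) * R + W * B * η := by
  unfold affineMapAt
  have hnW : (n : ℝ) ≤ W := by exact_mod_cast hn
  have key : (∑ j : Fin n, paramAt θ (s + i * n + j) * x j) + paramAt θ (s + m * n + i) -
      ((∑ j : Fin n, paramAt ϑ (s + i * n + j) * y j) + paramAt ϑ (s + m * n + i)) =
      (∑ j : Fin n, ((paramAt θ (s + i * n + j) - paramAt ϑ (s + i * n + j)) * x j +
        paramAt ϑ (s + i * n + j) * (x j - y j))) +
        (paramAt θ (s + m * n + i) - paramAt ϑ (s + m * n + i)) := by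
    rw [add_sub_add_comm, ← Finset.sum_sub_distrib]
    congr 1
    refine Finset.sum_congr rfl fun j _ => by ring
  rw [key]
  calc _ ≤ |∑ j : Fin n, ((paramAt θ (s + i * n + j) - paramAt ϑ (s + i * n + j)) * x j +
        paramAt ϑ (s + i * n + j) * (x j - y j))| +
        |paramAt θ (s + m * n + i) - paramAt ϑ (s + m * n + i)| := abs_add_le _ _
    _ ≤ (∑ j : Fin n, (δ * R + B * η)) + δ * R := by
        gcongr
        · refine (Finset.abs_sum_le_sum_abs _ _).trans (Finset.sum_le_sum fun j _ => ?_)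
          refine (abs_add_le _ _).trans ?_
          rw [abs_mul, abs_mul]
          gcongr
          · exact hclose _ (weight_index_lt i j s)
          · exact hx j
          · exact abs_paramAt_le hB h _
          · exact hxy j
        · exact (hclose _ (bias_index_lt i s)).trans (le_mul_of_one_le_right hδ hR)
    _ = δ * (n + 1) * R + n * B * η := by simp; ring
    _ ≤ _ := by gcongr

/-- Every layer enlarges the bound by at most `B * (maxWidth l + 1)`, where `1 ≤ A` lets the bias
count as one more weighted input. Only hidden layers are covered: the rectifier does not increase
absolute values, whereas clipping may. -/
theorem abs_layerState_le {D L : ℕ} {θ : Fin D → ℝ} {l : Fin (L + 1) → ℕ} {u v B A : ℝ}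
    (hB : 1 ≤ B) (hA : 1 ≤ A) (h : ∀ i, |θ i| ≤ B) {x : Fin (l 0) → ℝ} (hx : ∀ j, |x j| ≤ A)
    (i : Fin (L + 1)) (hi : (i : ℕ) < L) (k : Fin (l i)) :
    |layerState θ l u v i x k| ≤ A * (B * (maxWidth l + 1)) ^ (i : ℕ) := by
  induction i using Fin.induction with
  | zero => simpa [layerState_zero] using hx k
  | succ i ih =>
    rw [layerState_succ, if_neg (by simpa using hi.ne)]
    refine (abs_rectifier_le _).trans ?_
    have hW : (0 : ℝ) ≤ maxWidth l := Nat.cast_nonneg _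
    have hone : (1 : ℝ) ≤ B * (maxWidth l + 1) := by nlinarith
    refine (abs_affineMapAt_le (zero_le_one.trans hB) h
      (one_le_mul_of_one_le_of_one_le hA (one_le_pow₀ hone)) (le_maxWidth l _)
      (ih (by simp at hi ⊢)) k).trans ?_
    simp only [Fin.val_castSucc, Fin.val_succ]
    exact le_of_eq (by ring)

/-- A new layer contributes its own parameter perturbation times the size of its input, and passes
on the earlier error amplified by at most `B * maxWidth l`. Both activations are 1-Lipschitz. All
contributions have the same order, whence the factor `i`. -/
theorem abs_layerState_sub_le {D L : ℕ} {θ ϑ : Fin D → ℝ} {l : Fin (L + 1) → ℕ} {u v B A δ : ℝ}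
    (hB : 1 ≤ B) (hA : 1 ≤ A) (hδ : 0 ≤ δ) (hθ : ∀ i, |θ i| ≤ B) (hϑ : ∀ i, |ϑ i| ≤ B)
    (hclose : ∀ i < numParams l, |paramAt θ i - paramAt ϑ i| ≤ δ)
    {x : Fin (l 0) → ℝ} (hx : ∀ j, |x j| ≤ A) (i : Fin (L + 1)) (k : Fin (l i)) :
    |layerState θ l u v i x k - layerState ϑ l u v i x k| ≤
      i * A * (maxWidth l + 1) ^ (i : ℕ) * B ^ ((i : ℕ) - 1) * δ := by
  have hB0 : 0 ≤ B := zero_le_one.trans hB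
  have hW : (0 : ℝ) ≤ maxWidth l := Nat.cast_nonneg _
  have hA0 : 0 ≤ A := zero_le_one.trans hA
  induction i using Fin.induction with
  | zero => simp [layerState_zero]
  | succ i ih =>
    have hact : |layerState θ l u v i.succ x k - layerState ϑ l u v i.succ x k| ≤
        |affineMapAt θ (layerOffset l i) (l i.succ) (l i.castSucc)
          (layerState θ l u v i.castSucc x) k -
        affineMapAt ϑ (layerOffset l i) (l i.succ) (l i.castSucc)
          (layerState ϑ l u v i.castSucc x) k| := by
      rw [layerState_succ, layerState_succ]
      split_ifs
      · exact abs_clipping_sub_le _ _ _ _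
      · exact abs_rectifier_sub_le _ _
    refine hact.trans ?_
    have hone : (1 : ℝ) ≤ B * (maxWidth l + 1) := by nlinarith
    refine (abs_affineMapAt_sub_le hB0 hϑ (one_le_mul_of_one_le_of_one_le hA (one_le_pow₀ hone))
      hδ (by positivity) (le_maxWidth l i.castSucc)
      (fun j hj => hclose j (hj.trans_le (layerOffset_add_le l i)))
      (abs_layerState_le hB hA hθ hx i.castSucc (by simp)) ih k).trans ?_
    simp only [Fin.val_castSucc, Fin.val_succ]
    -- For `i = 0` the truncated exponent `i - 1` is harmless because the factor `i` vanishes.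
    have hBi : B * (i * B ^ ((i : ℕ) - 1)) = i * B ^ (i : ℕ) := by
      rcases Nat.eq_zero_or_pos (i : ℕ) with h0 | h0
      · simp [h0]
      · obtain ⟨t, ht⟩ : ∃ t, (i : ℕ) = t + 1 := ⟨i - 1, by omega⟩
        rw [ht]; simp; ring
    generalize (maxWidth l : ℝ) = w at *
    calc _ = (w + 1) ^ ((i : ℕ) + 1) * A * B ^ (i : ℕ) * δ +
          w * A * (w + 1) ^ (i : ℕ) * δ * (B * (i * B ^ ((i : ℕ) - 1))) := by
            rw [mul_pow]; ring
      _ = (w + 1) ^ ((i : ℕ) + 1) * A * B ^ (i : ℕ) * δ +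
          w * A * (w + 1) ^ (i : ℕ) * δ * (i * B ^ (i : ℕ)) := by rw [hBi]
      _ ≤ (w + 1) ^ ((i : ℕ) + 1) * A * B ^ (i : ℕ) * δ +
          (w + 1) * A * (w + 1) ^ (i : ℕ) * δ * (i * B ^ (i : ℕ)) := by
        gcongr; linarith
      _ = _ := by push_cast; ring

theorem abs_clippedNetReal_sub_le {d D L : ℕ} {l : Fin (L + 1) → ℕ} (hin : l 0 = d)
    (hout : l (Fin.last L) = 1) {θ ϑ : Fin D → ℝ} {u v B A δ : ℝ}
    (hB : 1 ≤ B) (hA : 1 ≤ A) (hδ : 0 ≤ δ) (hθ : ∀ i, |θ i| ≤ B) (hϑ : ∀ i, |ϑ i| ≤ B)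
    (hclose : ∀ i < numParams l, |paramAt θ i - paramAt ϑ i| ≤ δ)
    {x : Fin d → ℝ} (hx : ∀ j, |x j| ≤ A) :
    |clippedNetReal l hin hout u v θ x - clippedNetReal l hin hout u v ϑ x| ≤
      L * A * (maxWidth l + 1) ^ L * B ^ (L - 1) * δ := by
  have := abs_layerState_sub_le (u := u) (v := v) hB hA hδ hθ hϑ hclose
    (x := fun i => x (Fin.cast hin i)) (fun j => hx _) (Fin.last L) (Fin.cast hout.symm 0)
  simpa [clippedNetReal, clippedNet_eq_layerState] using this

theorem clippedNetReal_mem {d D L : ℕ} {l : Fin (L + 1) → ℕ} (hL : 1 ≤ L) (hin : l 0 = d)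
    (hout : l (Fin.last L) = 1) {u v : ℝ} (huv : u ≤ v) (θ : Fin D → ℝ) (x : Fin d → ℝ) :
    clippedNetReal l hin hout u v θ x ∈ Set.Icc u v := by
  obtain ⟨L, rfl⟩ : ∃ t, L = t + 1 := ⟨L - 1, by omega⟩
  unfold clippedNetReal
  rw [clippedNet_eq_layerState]
  have := layerState_succ θ l u v (Fin.last L) (fun i => x (Fin.cast hin i))
    (Fin.cast hout.symm 0)
  rw [if_pos (by simp)] at this
  erw [this]
  exact clipping_mem huv _

theorem continuous_paramAt {D : ℕ} (i : ℕ) : Continuous fun θ : Fin D → ℝ => paramAt θ i := by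
  unfold paramAt
  split_ifs
  · fun_prop
  · fun_prop

/-- Joint continuity, rather than continuity in the input alone, is what makes the error at a random
parameter vector measurable. -/
theorem continuous_layerState {D L : ℕ} (l : Fin (L + 1) → ℕ) (u v : ℝ) (i : Fin (L + 1)) :
    Continuous fun q : (Fin D → ℝ) × (Fin (l 0) → ℝ) => layerState q.1 l u v i q.2 := by
  induction i using Fin.induction with
  | zero => exact continuous_snd
  | succ i ih =>
    refine continuous_pi fun k => ?_
    have haff : Continuous fun q : (Fin D → ℝ) × (Fin (l 0) → ℝ) =>
        affineMapAt q.1 (layerOffset l i) (l i.succ) (l i.castSucc)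
          (layerState q.1 l u v i.castSucc q.2) k := by
      unfold affineMapAt
      refine Continuous.add (continuous_finsetSum _ fun j _ => ?_)
        ((continuous_paramAt _).comp continuous_fst)
      exact ((continuous_paramAt _).comp continuous_fst).mul ((continuous_apply j).comp ih)
    simp only [layerState_succ]
    split_ifs
    · exact continuous_const.max (haff.min continuous_const)
    · exact haff.max continuous_const

theorem continuous_clippedNetReal {d D L : ℕ} {l : Fin (L + 1) → ℕ} (hin : l 0 = d)
    (hout : l (Fin.last L) = 1) (u v : ℝ) :
    Continuous fun q : (Fin D → ℝ) × (Fin d → ℝ) => clippedNetReal l hin hout u v q.1 q.2 := by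
  have h := continuous_layerState (D := D) l u v (Fin.last L)
  have h2 : Continuous fun q : (Fin D → ℝ) × (Fin d → ℝ) =>
      ((q.1, fun i => q.2 (Fin.cast hin i)) : (Fin D → ℝ) × (Fin (l 0) → ℝ)) := by fun_prop
  exact (continuous_apply _).comp (h.comp h2)

/-! ### Random search -/

/-- On `[0, 1]` this is convexity of `Γ` on `[1, 2]`, with value 1 at both ends; the functional
equation then propagates it over unit intervals. -/
theorem Gamma_add_one_le {s : ℝ} (hs : 0 ≤ s) : Real.Gamma (s + 1) ≤ (max 1 s) ^ s := by
  suffices h : ∀ n : ℕ, ∀ s : ℝ, n ≤ s → s ≤ n + 1 → Real.Gamma (s + 1) ≤ (max 1 s) ^ s from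
    h ⌊s⌋₊ s (Nat.floor_le hs) (Nat.lt_floor_add_one s).le
  intro n
  induction n with
  | zero =>
    intro s hs0 hs1
    simp only [Nat.cast_zero, zero_add] at hs0 hs1
    rw [max_eq_left hs1, Real.one_rpow]
    have := Real.convexOn_Gamma.le_max_of_mem_Icc (x := 1) (y := 2) (z := s + 1)
      (by simp) (by simp) ⟨by linarith, by linarith⟩
    simpa using this
  | succ n ih =>
    intro s hs0 hs1
    push_cast at hs0 hs1
    have hn : (0 : ℝ) ≤ n := n.cast_nonneg
    have hs : 1 ≤ s := by linarith
    rw [Real.Gamma_add_one (by positivity), max_eq_right hs]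
    have := ih (s - 1) (by linarith) (by linarith)
    rw [sub_add_cancel] at this
    calc s * Real.Gamma s ≤ s * (max 1 (s - 1)) ^ (s - 1) := by gcongr
      _ ≤ s * s ^ (s - 1) := by
        gcongr
        exact max_le hs (by linarith)
      _ = s ^ s := by
        conv_lhs => rw [mul_comm, ← Real.rpow_add_one (by positivity)]
        simp

theorem eLpNorm_ofReal_eq {Ω : Type*} [MeasurableSpace Ω] (P : Measure Ω) {f : Ω → ℝ}
    (hf : ∀ ω, 0 ≤ f ω) {q : ℝ} (hq : 0 < q) :
    eLpNorm f (ENNReal.ofReal q) P = (∫⁻ ω, ENNReal.ofReal (f ω ^ q) ∂P) ^ (1 / q) := by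
  rw [eLpNorm_eq_lintegral_rpow_enorm_toReal (by simpa using hq) ENNReal.ofReal_ne_top,
    ENNReal.toReal_ofReal hq.le]
  congr 2
  ext ω
  rw [Real.enorm_eq_ofReal (hf ω), ENNReal.ofReal_rpow_of_nonneg (hf ω) hq.le]

/-- The layer-cake formula turns the tail into a Gamma integral with value `K ^ (-q / n) * Γ(q / n +
1)`, and this Gamma value is at most `q ^ q`. -/
theorem eLpNorm_le_of_tail {Ω : Type*} [MeasurableSpace Ω] (P : Measure Ω) {t : Ω → ℝ}
    (ht : Measurable t) (ht0 : ∀ ω, 0 ≤ t ω) {K n q : ℝ} (hK : 0 < K) (hn : 1 ≤ n) (hq : 1 ≤ q)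
    (htail : ∀ x, 0 < x → P {ω | x < t ω} ≤ ENNReal.ofReal (Real.exp (-K * x ^ n))) :
    eLpNorm t (ENNReal.ofReal q) P ≤ ENNReal.ofReal (q * K ^ (-(1 / n))) := by
  have hq0 : 0 < q := by linarith
  have hn0 : 0 < n := by linarith
  have hint : ∫⁻ ω, ENNReal.ofReal (t ω ^ q) ∂P ≤ ENNReal.ofReal ((q * K ^ (-(1 / n))) ^ q) := by
    rw [lintegral_rpow_eq_lintegral_meas_lt_mul P (Filter.Eventually.of_forall ht0)
      ht.aemeasurable hq0]
    calc _ ≤ ENNReal.ofReal q * ∫⁻ x in Set.Ioi 0,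
          ENNReal.ofReal (x ^ (q - 1) * Real.exp (-K * x ^ n)) := by
          gcongr 1
          refine setLIntegral_mono' measurableSet_Ioi fun x hx => ?_
          rw [mul_comm, ENNReal.ofReal_mul (Real.rpow_nonneg (le_of_lt hx) _)]
          gcongr
          exact htail x hx
      _ = ENNReal.ofReal (q * ∫ x in Set.Ioi 0, x ^ (q - 1) * Real.exp (-K * x ^ n)) := by
          rw [ENNReal.ofReal_mul hq0.le, ofReal_integral_eq_lintegral_ofReal]
          · exact integrableOn_rpow_mul_exp_neg_mul_rpow (by linarith) hn0 hK
          · refine (ae_restrict_iff' measurableSet_Ioi).2 (Filter.Eventually.of_forall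
              fun x hx => ?_)
            exact mul_nonneg (Real.rpow_nonneg (le_of_lt hx) _) (Real.exp_nonneg _)
      _ ≤ _ := by
          apply ENNReal.ofReal_le_ofReal
          rw [integral_rpow_mul_exp_neg_mul_rpow hn0 (by linarith) hK]
          simp only [sub_add_cancel]
          have h1 : q * (K ^ (-q / n) * (1 / n) * Real.Gamma (q / n)) =
              K ^ (-q / n) * Real.Gamma (q / n + 1) := by
            rw [Real.Gamma_add_one (by positivity)]; ring
          have hs : 0 ≤ q / n := by positivity
          have hmax : max 1 (q / n) ≤ q := max_le hq (div_le_self hq0.le hn)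
          rw [h1, Real.mul_rpow hq0.le (by positivity), ← Real.rpow_mul hK.le,
            show -(1 / n) * q = -q / n by ring, mul_comm (q ^ q)]
          gcongr
          calc Real.Gamma (q / n + 1) ≤ (max 1 (q / n)) ^ (q / n) := Gamma_add_one_le hs
            _ ≤ q ^ (q / n) := by gcongr
            _ ≤ q ^ q := Real.rpow_le_rpow_of_exponent_le hq (div_le_self hq0.le hn)
  rw [eLpNorm_ofReal_eq P ht0 hq0]
  calc _ ≤ (ENNReal.ofReal ((q * K ^ (-(1 / n))) ^ q)) ^ (1 / q) := by gcongr
    _ = _ := by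
      rw [ENNReal.ofReal_rpow_of_nonneg (by positivity) (by positivity), ← Real.rpow_mul
        (by positivity), mul_one_div_cancel hq0.ne', Real.rpow_one]

/-- By independence all variables exceed `x` with probability at most `(1 - y) ^ card ι`, and `1 - y
≤ exp (-y)`. -/
theorem measure_lt_iInf_le {Ω ι : Type*} [MeasurableSpace Ω] (P : Measure Ω)
    [IsProbabilityMeasure P] [Fintype ι] [Nonempty ι] {Z : ι → Ω → ℝ} (hZ : ∀ i, Measurable (Z i))
    (hind : iIndepFun Z P) {x y : ℝ} (hx : ∀ i, y ≤ P.real {ω | Z i ω ≤ x}) :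
    P {ω | x < ⨅ i, Z i ω} ≤ ENNReal.ofReal (Real.exp (-(Fintype.card ι) * y)) := by
  have hset : {ω | x < ⨅ i, Z i ω} ⊆ ⋂ i ∈ (Finset.univ : Finset ι), Z i ⁻¹' Set.Ioi x := by
    intro ω hω
    simp only [Finset.mem_univ, Set.iInter_true, Set.mem_iInter, Set.mem_preimage, Set.mem_Ioi]
    exact fun i => lt_of_lt_of_le hω (ciInf_le (Set.finite_range _).bddBelow i)
  refine (measure_mono hset).trans ?_
  rw [hind.measure_inter_preimage_eq_mul Finset.univ (fun _ _ => measurableSet_Ioi)]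
  calc ∏ i, P (Z i ⁻¹' Set.Ioi x) ≤ ∏ i : ι, ENNReal.ofReal (Real.exp (-y)) := by
        refine Finset.prod_le_prod' fun i _ => ?_
        have hc : Z i ⁻¹' Set.Ioi x = {ω | Z i ω ≤ x}ᶜ := by ext; simp
        have hm : MeasurableSet {ω | Z i ω ≤ x} := measurableSet_le (hZ i) measurable_const
        rw [hc, ← ofReal_measureReal, probReal_compl_eq_one_sub hm]
        apply ENNReal.ofReal_le_ofReal
        linarith [hx i, Real.add_one_le_exp (-y)]
    _ = _ := by
        rw [Finset.prod_const, ← ENNReal.ofReal_pow (Real.exp_nonneg _), ← Real.exp_nat_mul]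
        simp

/-- The worst case is `x` at an endpoint, where only one half of the neighbourhood remains inside.
-/
theorem volume_real_Icc_inter_Icc_ge {c x ε : ℝ} (hx : x ∈ Set.Icc (-c) c) (hε : 0 ≤ ε)
    (hεc : ε ≤ 2 * c) :
    ENNReal.ofReal ε ≤ volume (Set.Icc (-c) c ∩ Set.Icc (x - ε) (x + ε)) := by
  rw [Set.Icc_inter_Icc, Real.volume_Icc]
  apply ENNReal.ofReal_le_ofReal
  rcases hx with ⟨h1, h2⟩
  rcases max_cases (-c) (x - ε) with h | h <;> rcases min_cases c (x + ε) with h' | h' <;>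
    simp only [h.1, h'.1] <;> linarith

/-- A uniformly distributed point of a cube is close to a given point of the cube, in the first
`n` coordinates, with probability at least `δ ^ n`. -/
theorem uniform_measure_near_ge {Ω : Type*} [MeasurableSpace Ω] (P : Measure Ω)
    {D : ℕ} {c : ℝ} (hc : 0 < c) {Z : Ω → Fin D → ℝ}
    (hZ : Measurable Z) (hunif : pdf.IsUniform Z (Cube D (-c) c) P volume) (ϑ : Fin D → ℝ)
    (hϑ : ϑ ∈ Cube D (-c) c) {n : ℕ} (hn : n ≤ D) {δ : ℝ} (hδ : 0 ≤ δ) (hδ1 : δ ≤ 1) :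
    ENNReal.ofReal (δ ^ n) ≤
      P {ω | ‖fun i : Fin n => paramAt (Z ω) i - paramAt ϑ i‖ ≤ 2 * c * δ} := by
  have hε : 0 ≤ 2 * c * δ := by positivity
  -- Coordinates beyond the first `n` are unconstrained, so they contribute a factor 1 and the
  -- exponent is `n` instead of `D`.
  set A : Set (Fin D → ℝ) := Set.pi Set.univ fun i => if (i : ℕ) < n
    then Set.Icc (ϑ i - 2 * c * δ) (ϑ i + 2 * c * δ) else Set.univ with hA
  have hAm : MeasurableSet A := by
    refine MeasurableSet.univ_pi fun i => ?_
    split_ifs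
    exacts [measurableSet_Icc, MeasurableSet.univ]
  have hset : Z ⁻¹' A ⊆ {ω | ‖fun i : Fin n => paramAt (Z ω) i - paramAt ϑ i‖ ≤ 2 * c * δ} := by
    intro ω hω
    refine (pi_norm_le_iff_of_nonneg hε).2 fun i => ?_
    have hiD : (i : ℕ) < D := i.2.trans_le hn
    have := hω ⟨i, hiD⟩ (Set.mem_univ _)
    simp only [Fin.is_lt, if_true, Set.mem_Icc] at this
    simp only [paramAt, hiD, dif_pos, Real.norm_eq_abs]
    exact abs_le.2 ⟨by linarith, by linarith⟩
  refine le_trans ?_ (measure_mono hset)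
  rw [← Measure.map_apply hZ hAm, hunif, cond_apply measurableSet_Icc]
  have hcube : (Set.Icc (fun _ => -c) fun _ => c : Set (Fin D → ℝ)) =
     Set.pi Set.univ fun _ => Set.Icc (-c) c :=
    (Set.pi_univ_Icc _ _).symm
  rw [hcube, hA, ← Set.pi_inter_distrib, volume_pi_pi, volume_pi_pi]
  simp only [Real.volume_Icc]
  have h2c : c - -c = 2 * c := by ring
  have hne : (∏ _i : Fin D, ENNReal.ofReal (c - -c)) ≠ 0 := by
    rw [Finset.prod_ne_zero_iff]; intro i _; rw [h2c]; simpa using hc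
  have hnt : (∏ _i : Fin D, ENNReal.ofReal (c - -c)) ≠ ⊤ := by
    rw [Finset.prod_const]; finiteness
  rw [← ENNReal.mul_le_mul_iff_right hne hnt, ← mul_assoc,
    ENNReal.mul_inv_cancel hne hnt, one_mul]
  have hfac : ENNReal.ofReal (δ ^ n) = ∏ i : Fin D, if (i : ℕ) < n then ENNReal.ofReal δ else 1 := by
    rw [Finset.prod_ite, Finset.prod_const, Finset.prod_const, one_pow, mul_one,
      ENNReal.ofReal_pow hδ]
    congr 1
    rw [← Fintype.card_subtype, Fintype.card_congr (β := Fin n)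
      ⟨fun i => ⟨i.1, i.2⟩, fun i => ⟨⟨i, i.2.trans_le hn⟩, i.2⟩, fun _ => rfl, fun _ => rfl⟩]
    simp
  rw [hfac, ← Finset.prod_mul_distrib]
  refine Finset.prod_le_prod' fun i _ => ?_
  split_ifs with hi
  · rw [← ENNReal.ofReal_mul (by linarith), h2c]
    exact volume_real_Icc_inter_Icc_ge ⟨hϑ.1 i, hϑ.2 i⟩ hε (by nlinarith)
  · simp

/-- Random search: the `L^q` distance of the best of `K` independent uniformly distributed points
of a cube to a given point, measured in the first `n` coordinates. -/
theorem eLpNorm_iInf_dist_le {Ω ι : Type*} [MeasurableSpace Ω] (P : Measure Ω)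
    [IsProbabilityMeasure P] [Fintype ι] [Nonempty ι] {D : ℕ} {c : ℝ} (hc : 0 < c)
    {Z : ι → Ω → Fin D → ℝ} (hZ : ∀ i, Measurable (Z i)) (hind : iIndepFun Z P)
    (hunif : ∀ i, pdf.IsUniform (Z i) (Cube D (-c) c) P volume) (ϑ : Fin D → ℝ)
    (hϑ : ϑ ∈ Cube D (-c) c) {n : ℕ} (hn : n ≤ D) (hn1 : 1 ≤ n) {q : ℝ} (hq : 1 ≤ q) :
    Measurable (fun ω => ⨅ k, ‖fun i : Fin n => paramAt (Z k ω) i - paramAt ϑ i‖) ∧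
    eLpNorm (fun ω => ⨅ k, ‖fun i : Fin n => paramAt (Z k ω) i - paramAt ϑ i‖)
      (ENNReal.ofReal q) P ≤
      ENNReal.ofReal (2 * c * q * (Fintype.card ι : ℝ) ^ (-(1 / (n : ℝ)))) := by
  set g : (Fin D → ℝ) → ℝ := fun θ => ‖fun i : Fin n => paramAt θ i - paramAt ϑ i‖ with hg
  have hgm : Measurable g := by
    apply Continuous.measurable
    refine continuous_norm.comp (continuous_pi fun i => ?_)
    exact (continuous_paramAt _).sub continuous_const
  have hgZ : ∀ k, Measurable fun ω => g (Z k ω) := fun k => hgm.comp (hZ k)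
  have hm : Measurable fun ω => ⨅ k, g (Z k ω) := Measurable.iInf hgZ
  refine ⟨hm, ?_⟩
  have hpos : ∀ ω, 0 ≤ ⨅ k, g (Z k ω) := fun ω => Real.iInf_nonneg fun k => norm_nonneg _
  have hind' : iIndepFun (fun k ω => g (Z k ω)) P := hind.comp (fun _ => g) (fun _ => hgm)
  have hprob : ∀ k, ∀ x, 0 ≤ x → x ≤ 1 → x ^ n ≤ P.real {ω | g (Z k ω) ≤ 2 * c * x} := by
    intro k x hx hx1
    have := uniform_measure_near_ge P hc (hZ k) (hunif k) ϑ hϑ hn hx hx1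
    rwa [← ofReal_measureReal, ENNReal.ofReal_le_ofReal_iff measureReal_nonneg] at this
  have htail : ∀ x, 0 < x → P {ω | x < (2 * c)⁻¹ * ⨅ k, g (Z k ω)} ≤
      ENNReal.ofReal (Real.exp (-(Fintype.card ι) * x ^ (n : ℝ))) := by
    intro x hx
    have hset : {ω | x < (2 * c)⁻¹ * ⨅ k, g (Z k ω)} = {ω | 2 * c * x < ⨅ k, g (Z k ω)} := by
      ext ω
      simp only [Set.mem_ofPred_eq]
      rw [inv_mul_eq_div, lt_div_iff₀ (by positivity), mul_comm]
    rw [hset, Real.rpow_natCast]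
    rcases le_or_gt x 1 with h1 | h1
    · exact measure_lt_iInf_le P hgZ hind' fun k => hprob k x hx.le h1
    -- Beyond the rescaled diameter 1 the tail vanishes: `hprob` at `x = 1` says that any single
    -- sample is within `2 * c` almost surely.
    · have k : ι := Classical.arbitrary ι
      have hk := hprob k 1 zero_le_one le_rfl
      rw [one_pow] at hk
      have hms : MeasurableSet {ω | g (Z k ω) ≤ 2 * c * 1} :=
        measurableSet_le (hgZ k) measurable_const
      have : P {ω | 2 * c * x < ⨅ k, g (Z k ω)} = 0 := by
        refine measure_mono_null (t := {ω | g (Z k ω) ≤ 2 * c * 1}ᶜ) ?_ ?_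
        · intro ω hω hω'
          have h2 := ciInf_le (f := fun k => g (Z k ω)) (Set.finite_range _).bddBelow k
          simp only [Set.mem_ofPred_eq] at hω hω'
          nlinarith
        · rw [prob_compl_eq_zero_iff hms, ← ofReal_measureReal]
          rw [le_antisymm measureReal_le_one hk, ENNReal.ofReal_one]
      rw [this]
      exact zero_le
  have hK : (0 : ℝ) < Fintype.card ι := by exact_mod_cast Fintype.card_pos
  have h := eLpNorm_le_of_tail P (hm.const_mul (2 * c)⁻¹)
    (fun ω => mul_nonneg (by positivity) (hpos ω)) hK (by exact_mod_cast hn1) hq htail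
  have heq : (fun ω => ⨅ k, g (Z k ω)) = (2 * c) • fun ω => (2 * c)⁻¹ * ⨅ k, g (Z k ω) := by
    ext ω
    simp only [Pi.smul_apply, smul_eq_mul]
    field_simp
  rw [heq, eLpNorm_const_smul, Real.enorm_eq_ofReal (by positivity)]
  calc _ ≤ ENNReal.ofReal (2 * c) * ENNReal.ofReal (q * (Fintype.card ι : ℝ) ^ (-(1 / (n : ℝ)))) := by
        gcongr
    _ = _ := by
        rw [← ENNReal.ofReal_mul (by positivity)]
        congr 1; ring

/-! ### A uniform law of large numbers over a parameter cube -/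

/-- A maximal inequality: the `L^q` norm of the maximum of finitely many sub-Gaussian random
variables. -/
theorem eLpNorm_iSup_abs_le_of_subgaussian {Ω ι : Type*} [MeasurableSpace Ω] (P : Measure Ω)
    [Fintype ι] [Nonempty ι] {Z : ι → Ω → ℝ} (hZm : ∀ i, Measurable (Z i)) {s q : ℝ} (hs : 0 < s)
    (hq : 1 ≤ q) (hcard : 2 * (Fintype.card ι : ℝ) ≤ Real.exp q)
    (hZ : ∀ i, HasSubgaussianMGF (Z i) (Real.toNNReal (s ^ 2)) P) :
    eLpNorm (fun ω => ⨆ i, |Z i ω|) (ENNReal.ofReal q) P ≤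
      ENNReal.ofReal (s * Real.sqrt q * Real.exp (1 / 2)) := by
  have hq0 : 0 < q := by linarith
  have hsq : 0 < Real.sqrt q := Real.sqrt_pos.2 hq0
  have hpos : ∀ ω, 0 ≤ ⨆ i, |Z i ω| := fun ω => Real.iSup_nonneg fun k => abs_nonneg _
  -- With this `t`, `s ^ 2 * t ^ 2 = q`, so each exponential moment is at most `exp (q / 2)`,
  -- comparable to the count `2 * card ι ≤ exp q`.
  set t : ℝ := Real.sqrt q / s with ht
  have ht0 : 0 < t := by positivity
  have hmgf : ∀ i, ∀ r : ℝ, r ^ 2 = t ^ 2 →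
      ∫⁻ ω, ENNReal.ofReal (Real.exp (r * Z i ω)) ∂P ≤ ENNReal.ofReal (Real.exp (q / 2)) := by
    intro i r hr
    rw [← ofReal_integral_eq_lintegral_ofReal ((hZ i).integrable_exp_mul r)
      (Filter.Eventually.of_forall fun _ => Real.exp_nonneg _)]
    apply ENNReal.ofReal_le_ofReal
    refine ((hZ i).mgf_le r).trans (le_of_eq ?_)
    rw [Real.coe_toNNReal _ (sq_nonneg s), hr, ht, div_pow, Real.sq_sqrt hq0.le]
    congr 1
    field_simp
  have hpt : ∀ ω, ENNReal.ofReal ((⨆ i, |Z i ω|) ^ q) ≤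
      ENNReal.ofReal ((q / (t * Real.exp 1)) ^ q) *
        ∑ i, (ENNReal.ofReal (Real.exp (t * Z i ω)) + ENNReal.ofReal (Real.exp (-t * Z i ω))) := by
    intro ω
    obtain ⟨i, hi⟩ := exists_eq_ciSup_of_finite (f := fun i => |Z i ω|)
    rw [← hi]
    have h1 : |Z i ω| ^ q ≤ (q / (t * Real.exp 1)) ^ q * Real.exp (t * |Z i ω|) := by
      -- This is `x ≤ exp (x - 1)` at `x = t * |Z i ω| / q`; its `q`-th power trades the `q`-th
      -- moment for an exponential one.
      have h2 : |Z i ω| ≤ q / (t * Real.exp 1) * Real.exp (t * |Z i ω| / q) := by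
        have h3 := Real.add_one_le_exp (t * |Z i ω| / q - 1)
        rw [sub_add_cancel, Real.exp_sub] at h3
        have h4 := mul_le_mul_of_nonneg_left h3 (show 0 ≤ q / t by positivity)
        calc |Z i ω| = q / t * (t * |Z i ω| / q) := by field_simp
          _ ≤ _ := h4
          _ = _ := by field_simp
      calc |Z i ω| ^ q ≤ (q / (t * Real.exp 1) * Real.exp (t * |Z i ω| / q)) ^ q := by gcongr
        _ = _ := by
          rw [Real.mul_rpow (by positivity) (by positivity), ← Real.exp_mul]
          congr 2; field_simp
    refine (ENNReal.ofReal_le_ofReal h1).trans ?_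
    rw [ENNReal.ofReal_mul (by positivity)]
    gcongr
    refine le_trans ?_ (Finset.single_le_sum (f := fun i => ENNReal.ofReal (Real.exp (t * Z i ω)) +
      ENNReal.ofReal (Real.exp (-t * Z i ω))) (fun _ _ => zero_le) (Finset.mem_univ i))
    rcases abs_choice (Z i ω) with h | h <;> rw [h]
    · exact le_self_add
    · rw [mul_neg, ← neg_mul]; exact le_add_self
  have hsum : ∫⁻ ω, ∑ i, (ENNReal.ofReal (Real.exp (t * Z i ω)) +
      ENNReal.ofReal (Real.exp (-t * Z i ω))) ∂P ≤ ENNReal.ofReal (Real.exp (3 / 2 * q)) := by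
    have hmeas : ∀ i, ∀ r : ℝ, Measurable fun ω => ENNReal.ofReal (Real.exp (r * Z i ω)) :=
      fun i r => (Real.measurable_exp.comp ((hZm i).const_mul r)).ennreal_ofReal
    rw [lintegral_finsetSum _ (fun i _ => Measurable.fun_add (hmeas i t) (hmeas i (-t)))]
    calc _ ≤ ∑ i : ι, (ENNReal.ofReal (Real.exp (q / 2)) + ENNReal.ofReal (Real.exp (q / 2))) := by
          refine Finset.sum_le_sum fun i _ => ?_
          rw [lintegral_add_left (hmeas i t)]
          exact add_le_add (hmgf i t rfl) (hmgf i (-t) (by ring))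
      _ = ENNReal.ofReal (2 * (Fintype.card ι : ℝ) * Real.exp (q / 2)) := by
          rw [Finset.sum_const, ← ENNReal.ofReal_add (by positivity) (by positivity),
            ← ENNReal.ofReal_nsmul]
          congr 1
          simp; ring
      _ ≤ _ := by
          apply ENNReal.ofReal_le_ofReal
          rw [show 3 / 2 * q = q + q / 2 by ring, Real.exp_add]
          gcongr
  rw [eLpNorm_ofReal_eq P hpos hq0]
  calc _ ≤ (ENNReal.ofReal ((q / (t * Real.exp 1)) ^ q) *
        ENNReal.ofReal (Real.exp (3 / 2 * q))) ^ (1 / q) := by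
        gcongr
        refine (lintegral_mono hpt).trans ?_
        rw [lintegral_const_mul' _ _ ENNReal.ofReal_ne_top]
        gcongr
    _ = _ := by
        rw [← ENNReal.ofReal_mul (by positivity), Real.exp_mul, ← Real.mul_rpow (by positivity)
          (by positivity), ENNReal.ofReal_rpow_of_nonneg (by positivity) (by positivity),
          ← Real.rpow_mul (by positivity), mul_one_div_cancel hq0.ne', Real.rpow_one]
        congr 1
        rw [show (3 / 2 : ℝ) = 1 + 1 / 2 by norm_num, Real.exp_add, ht]
        have := Real.mul_self_sqrt hq0.le
        have he := Real.exp_pos 1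
        field_simp
        nlinarith

/-- Empirical means of bounded i.i.d. random variables are sub-Gaussian around their mean. -/
theorem hasSubgaussianMGF_empirical_mean {Ω ι : Type*} [MeasurableSpace Ω] (P : Measure Ω)
    [IsProbabilityMeasure P] [Fintype ι] [Nonempty ι] {S : Type*} [MeasurableSpace S]
    {ξ : ι → Ω → S} {ξ₀ : Ω → S} (hind : iIndepFun ξ P)
    (hid : ∀ i, IdentDistrib (ξ i) ξ₀ P P) {ψ : S → ℝ} (hψ : Measurable ψ) {A : ℝ} (hA : 0 ≤ A)
    (hψA : ∀ x, ψ x ∈ Set.Icc 0 A) :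
    HasSubgaussianMGF (fun ω => (1 / (Fintype.card ι : ℝ)) * ∑ i, ψ (ξ i ω) - ∫ ω, ψ (ξ₀ ω) ∂P)
      (Real.toNNReal ((A / (2 * Real.sqrt (Fintype.card ι))) ^ 2)) P := by
  have hK : (0 : ℝ) < Fintype.card ι := by exact_mod_cast Fintype.card_pos
  have hmean : ∀ i, ∫ ω, ψ (ξ i ω) ∂P = ∫ ω, ψ (ξ₀ ω) ∂P := fun i =>
    ((hid i).comp hψ).integral_eq
  have hsub : ∀ i, HasSubgaussianMGF (fun ω => ψ (ξ i ω) - ∫ ω, ψ (ξ₀ ω) ∂P)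
      ((‖A - 0‖₊ / 2) ^ 2) P := by
    intro i
    rw [← hmean i]
    -- Hoeffding's lemma gives variance proxy `A ^ 2 / 4` for each summand; averaging divides it by
    -- `card ι`.
    exact hasSubgaussianMGF_of_mem_Icc (hψ.comp_aemeasurable (hid i).aemeasurable_fst)
      (Filter.Eventually.of_forall fun ω => hψA _)
  have hind' : iIndepFun (fun i ω => ψ (ξ i ω) - ∫ ω, ψ (ξ₀ ω) ∂P) P :=
    hind.comp (fun _ x => ψ x - ∫ ω, ψ (ξ₀ ω) ∂P) (fun _ => hψ.sub_const _)
  have h := (HasSubgaussianMGF.sum_of_iIndepFun hind' (s := Finset.univ)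
    (fun i _ => hsub i)).const_mul (1 / (Fintype.card ι : ℝ))
  convert! h using 1
  · ext ω
    rw [Finset.sum_sub_distrib, mul_sub, Finset.sum_const, nsmul_eq_mul, Finset.card_univ]
    field_simp
  · apply NNReal.eq
    rw [Real.coe_toNNReal _ (sq_nonneg _)]
    rw [Finset.sum_const, nsmul_eq_mul, Finset.card_univ, div_pow, mul_pow,
      Real.sq_sqrt hK.le, sub_zero]
    change _ = (1 / (Fintype.card ι : ℝ)) ^ 2 * (Fintype.card ι * (‖A‖ / 2) ^ 2)
    rw [Real.norm_eq_abs, abs_of_nonneg hA]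
    field_simp

/-- The points of a regular grid in the first `n` coordinates of `[-B, B]^D`. -/
def gridPoint (D n T : ℕ) (B : ℝ) (k : Fin n → Fin T) : Fin D → ℝ :=
  fun i => if h : (i : ℕ) < n then -B + (2 * ((k ⟨i, h⟩ : ℕ) : ℝ) + 1) * (B / T) else 0

theorem abs_gridPoint_le {D n T : ℕ} {B : ℝ} (hB : 0 ≤ B) (k : Fin n → Fin T) (i : Fin D) :
    |gridPoint D n T B k i| ≤ B := by
  unfold gridPoint
  split_ifs with h
  · have hk := (k ⟨i, h⟩).2
    have hT : (0 : ℝ) < T := by exact_mod_cast (Nat.zero_le _).trans_lt hk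
    have hk' : ((k ⟨i, h⟩ : ℕ) : ℝ) + 1 ≤ T := by exact_mod_cast hk
    have h0 : (0 : ℝ) ≤ ((k ⟨i, h⟩ : ℕ) : ℝ) := Nat.cast_nonneg _
    have hBT : 0 ≤ B / T := by positivity
    have hBT' : B = T * (B / T) := by field_simp
    generalize ((k ⟨i, h⟩ : ℕ) : ℝ) = κ at *
    rw [abs_le]
    constructor <;> nlinarith
  · simpa using hB

theorem exists_grid_near {T : ℕ} (hT : 0 < T) {B y : ℝ} (hB : 0 < B) (hy : |y| ≤ B) :
    ∃ k : Fin T, |y - (-B + (2 * ((k : ℕ) : ℝ) + 1) * (B / T))| ≤ B / T := by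
  obtain ⟨h1, h2⟩ := abs_le.1 hy
  have hT' : (0 : ℝ) < T := by exact_mod_cast hT
  have hr : 0 < B / T := by positivity
  have hBT : B = T * (B / T) := by field_simp
  set r := B / T
  have hz : 0 ≤ (y + B) / (2 * r) := div_nonneg (by linarith) (by linarith)
  have hyz : y + B = (y + B) / (2 * r) * (2 * r) := by field_simp
  set z := (y + B) / (2 * r)
  by_cases hlt : z < T
  · have hf : ⌊z⌋₊ < T := (Nat.floor_lt hz).2 hlt
    refine ⟨⟨⌊z⌋₊, hf⟩, ?_⟩
    have h3 := Nat.floor_le hz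
    have h4 := Nat.lt_floor_add_one z
    simp only
    generalize (⌊z⌋₊ : ℝ) = w at *
    rw [abs_le]
    constructor <;> nlinarith
  -- Only the right endpoint `y = B` gets here; it belongs to the last cell.
  · refine ⟨⟨T - 1, by omega⟩, ?_⟩
    push Not at hlt
    have hz2 : z ≤ T := by
      by_contra hcon
      push Not at hcon
      nlinarith
    have hzT : z = T := le_antisymm hz2 hlt
    simp only
    rw [Nat.cast_sub (by omega), abs_le, Nat.cast_one]
    constructor <;> nlinarith

theorem exists_gridPoint_near {D n T : ℕ} (hT : 0 < T) {B : ℝ} (hB : 0 < B) (θ : Fin D → ℝ)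
    (hθ : ∀ i, |θ i| ≤ B) :
    ∃ k : Fin n → Fin T, ∀ i < n, |paramAt θ i - paramAt (gridPoint D n T B k) i| ≤ B / T := by
  choose k hk using fun i : Fin n => exists_grid_near hT hB (abs_paramAt_le hB.le hθ i)
  refine ⟨k, fun i hi => ?_⟩
  by_cases hiD : i < D
  · have := hk ⟨i, hi⟩
    simpa only [paramAt, hiD, dif_pos, gridPoint, hi] using this
  · simp only [paramAt, hiD, dif_neg, not_false_eq_true, sub_self, abs_zero]
    positivity

/-- A uniform law of large numbers over a bounded parameter set for a loss which is bounded and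
Lipschitz continuous in the first `n` parameters. -/
theorem exists_uniform_deviation_bound {Ω ι : Type*} [MeasurableSpace Ω] (P : Measure Ω)
    [IsProbabilityMeasure P] [Fintype ι] [Nonempty ι] {S : Type*} [MeasurableSpace S]
    {ξ : ι → Ω → S} {ξ₀ : Ω → S} (hξ : ∀ i, Measurable (ξ i)) (hξ₀ : Measurable ξ₀)
    (hind : iIndepFun ξ P) (hid : ∀ i, IdentDistrib (ξ i) ξ₀ P P) {D n T : ℕ} (hT : 0 < T)
    {ψ : (Fin D → ℝ) → S → ℝ} (hψ : ∀ θ, Measurable (ψ θ)) {A B Λ : ℝ} (hA : 0 < A) (hB : 0 < B)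
    (hψA : ∀ θ x, ψ θ x ∈ Set.Icc 0 A)
    (hΛ : ∀ θ ϑ : Fin D → ℝ, (∀ i, |θ i| ≤ B) → (∀ i, |ϑ i| ≤ B) → ∀ δ, 0 ≤ δ →
      (∀ i < n, |paramAt θ i - paramAt ϑ i| ≤ δ) → ∀ x, |ψ θ x - ψ ϑ x| ≤ Λ * δ)
    {q : ℝ} (hq : 1 ≤ q) (hqT : 2 * (T : ℝ) ^ n ≤ Real.exp q) :
    ∃ G : Ω → ℝ, Measurable G ∧ (∀ ω, 0 ≤ G ω) ∧
      (∀ θ : Fin D → ℝ, (∀ i, |θ i| ≤ B) → ∀ ω,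
        |(1 / (Fintype.card ι : ℝ)) * ∑ i, ψ θ (ξ i ω) - ∫ ω, ψ θ (ξ₀ ω) ∂P| ≤
          G ω + 2 * (Λ * (B / T))) ∧
      eLpNorm G (ENNReal.ofReal q) P ≤
        ENNReal.ofReal (A / (2 * Real.sqrt (Fintype.card ι)) * Real.sqrt q * Real.exp (1 / 2)) := by
  have hK : (0 : ℝ) < Fintype.card ι := by exact_mod_cast Fintype.card_pos
  set dev : (Fin D → ℝ) → Ω → ℝ := fun θ ω =>
    (1 / (Fintype.card ι : ℝ)) * ∑ i, ψ θ (ξ i ω) - ∫ ω, ψ θ (ξ₀ ω) ∂P with hdev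
  have : Nonempty (Fin T) := ⟨⟨0, hT⟩⟩
  have hdevm : ∀ θ, Measurable (dev θ) := fun θ => by
    refine (Measurable.const_mul ?_ _).sub_const _
    exact Finset.measurable_fun_sum _ fun i _ => (hψ θ).comp (hξ i)
  have hint : ∀ θ, Integrable (fun ω => ψ θ (ξ₀ ω)) P := fun θ =>
    Integrable.of_mem_Icc 0 A ((hψ θ).comp hξ₀).aemeasurable
      (Filter.Eventually.of_forall fun ω => hψA _ _)
  -- `G` is the largest deviation over the `T ^ n` grid points. Passing from `θ` to its neighbouring
  -- grid point costs `Λ * (B / T)` in the empirical mean and again in the expectation.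
  refine ⟨fun ω => ⨆ k : Fin n → Fin T, |dev (gridPoint D n T B k) ω|, ?_, ?_, ?_, ?_⟩
  · exact Measurable.iSup fun k => (hdevm _).abs
  · exact fun ω => Real.iSup_nonneg fun k => abs_nonneg _
  · intro θ hθ ω
    obtain ⟨k, hk⟩ := exists_gridPoint_near (n := n) hT hB θ hθ
    have hr : 0 ≤ B / T := by positivity
    have hx := hΛ θ _ hθ (fun i => abs_gridPoint_le hB.le k i) _ hr hk
    set ϑ := gridPoint D n T B k
    have h1 : |(1 / (Fintype.card ι : ℝ)) * ∑ i, ψ θ (ξ i ω) -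
        (1 / (Fintype.card ι : ℝ)) * ∑ i, ψ ϑ (ξ i ω)| ≤ Λ * (B / T) := by
      rw [← mul_sub, ← Finset.sum_sub_distrib, abs_mul, abs_of_nonneg (by positivity)]
      calc _ ≤ (1 / (Fintype.card ι : ℝ)) * ∑ _i : ι, Λ * (B / T) := by
            gcongr
            exact (Finset.abs_sum_le_sum_abs _ _).trans (Finset.sum_le_sum fun i _ => hx _)
        _ = _ := by
            rw [Finset.sum_const, nsmul_eq_mul, Finset.card_univ]; field_simp
    have h2 : |∫ ω, ψ θ (ξ₀ ω) ∂P - ∫ ω, ψ ϑ (ξ₀ ω) ∂P| ≤ Λ * (B / T) := by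
      rw [← integral_sub (hint θ) (hint ϑ)]
      have := norm_integral_le_of_norm_le_const (μ := P) (C := Λ * (B / T))
        (f := fun ω => ψ θ (ξ₀ ω) - ψ ϑ (ξ₀ ω)) (Filter.Eventually.of_forall fun ω => hx _)
      simpa using this
    have h3 : |dev ϑ ω| ≤ ⨆ k : Fin n → Fin T, |dev (gridPoint D n T B k) ω| :=
      le_ciSup (f := fun k : Fin n → Fin T => |dev (gridPoint D n T B k) ω|)
        (Set.finite_range _).bddAbove k
    simp only [hdev] at h3
    rw [abs_le] at h1 h2 h3 ⊢
    constructor <;> linarith [h1.1, h1.2, h2.1, h2.2, h3.1, h3.2]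
  · refine eLpNorm_iSup_abs_le_of_subgaussian P (fun k => hdevm _) (by positivity) hq ?_ ?_
    · simpa using hqT
    · exact fun k => hasSubgaussianMGF_empirical_mean P hind hid (hψ _) hA.le (hψA _)

/-! ### Parameter vectors with prescribed weights and biases -/

theorem layerOffset_add_le_layerOffset {L : ℕ} (l : Fin (L + 1) → ℕ) {i j : Fin L} (h : i < j) :
    layerOffset l i + l i.succ * (l i.castSucc + 1) ≤ layerOffset l j := by
  unfold layerOffset
  have hi : i ∉ Finset.Iio i := by simp
  rw [add_comm, ← Finset.sum_insert (f := fun j : Fin L => l j.succ * (l j.castSucc + 1)) hi]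
  refine Finset.sum_le_sum_of_subset fun t ht => ?_
  simp only [Finset.mem_insert, Finset.mem_Iio] at ht ⊢
  rcases ht with rfl | ht
  exacts [h, ht.trans h]

/-- The position in the parameter vector of the weights and biases of a network. -/
def paramIndex {L : ℕ} (l : Fin (L + 1) → ℕ) :
    (Σ i : Fin L, (Fin (l i.succ) × Fin (l i.castSucc)) ⊕ Fin (l i.succ)) → ℕ
  | ⟨i, .inl (r, t)⟩ => layerOffset l i + r * l i.castSucc + t
  | ⟨i, .inr r⟩ => layerOffset l i + l i.succ * l i.castSucc + r

theorem le_paramIndex {L : ℕ} (l : Fin (L + 1) → ℕ)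
    (a : Σ i : Fin L, (Fin (l i.succ) × Fin (l i.castSucc)) ⊕ Fin (l i.succ)) :
    layerOffset l a.1 ≤ paramIndex l a ∧
      paramIndex l a < layerOffset l a.1 + l a.1.succ * (l a.1.castSucc + 1) := by
  rcases a with ⟨i, ⟨r, t⟩ | r⟩
  · exact ⟨by simp only [paramIndex]; omega, weight_index_lt r t _⟩
  · exact ⟨by simp only [paramIndex]; omega, bias_index_lt r _⟩

theorem eq_of_mul_add_eq {n r r' t t' : ℕ} (ht : t < n) (ht' : t' < n)
    (h : r * n + t = r' * n + t') : r = r' ∧ t = t' := by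
  have hr : r = r' := by
    have h1 : (r * n + t) / n = r := by
      rw [add_comm, Nat.add_mul_div_right _ _ (by omega), Nat.div_eq_of_lt ht, zero_add]
    have h2 : (r' * n + t') / n = r' := by
      rw [add_comm, Nat.add_mul_div_right _ _ (by omega), Nat.div_eq_of_lt ht', zero_add]
    rw [← h1, ← h2, h]
  subst hr
  exact ⟨rfl, by omega⟩

/-- Different layers occupy disjoint blocks of indices; within a block, row and column are quotient
and remainder, and the biases follow all weights. -/
theorem paramIndex_injective {L : ℕ} (l : Fin (L + 1) → ℕ) :
    Function.Injective (paramIndex l) := by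
  intro a a' h
  have h1 := le_paramIndex l a
  have h2 := le_paramIndex l a'
  have hi : a.1 = a'.1 := by
    rcases lt_trichotomy a.1 a'.1 with hlt | heq | hlt
    · have := layerOffset_add_le_layerOffset l hlt; omega
    · exact heq
    · have := layerOffset_add_le_layerOffset l hlt; omega
  obtain ⟨i, x⟩ := a
  obtain ⟨i', x'⟩ := a'
  simp only at hi
  subst hi
  have hmul : ∀ r : Fin (l i.succ), (r : ℕ) * l i.castSucc + l i.castSucc
      ≤ l i.succ * l i.castSucc := fun r => by
    rw [← Nat.succ_mul]; exact Nat.mul_le_mul_right _ r.2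
  rcases x with ⟨r, t⟩ | r <;> rcases x' with ⟨r', t'⟩ | r' <;> simp only [paramIndex] at h
  · obtain ⟨hr, ht⟩ := eq_of_mul_add_eq t.2 t'.2 (by omega : (r : ℕ) * l i.castSucc + t =
      r' * l i.castSucc + t')
    rw [Fin.ext hr, Fin.ext ht]
  · have := hmul r; have := t.2; omega
  · have := hmul r'; have := t'.2; omega
  · rw [Fin.ext (by omega : (r : ℕ) = r')]

/-- Every choice of bounded weights and biases is realized by a parameter vector. -/
theorem exists_param {D L : ℕ} (l : Fin (L + 1) → ℕ) (hD : numParams l ≤ D) {c : ℝ} (hc : 0 ≤ c)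
    (w : ℕ → ℕ → ℕ → ℝ) (β : ℕ → ℕ → ℝ) (hw : ∀ i r t, |w i r t| ≤ c) (hβ : ∀ i r, |β i r| ≤ c) :
    ∃ θ : Fin D → ℝ, θ ∈ Cube D (-c) c ∧ ∀ (i : Fin L) (x : Fin (l i.castSucc) → ℝ)
      (r : Fin (l i.succ)), affineMapAt θ (layerOffset l i) (l i.succ) (l i.castSucc) x r =
        ∑ t : Fin (l i.castSucc), w i r t * x t + β i r := by
  set val : (Σ i : Fin L, (Fin (l i.succ) × Fin (l i.castSucc)) ⊕ Fin (l i.succ)) → ℝ := fun a =>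
    Sum.elim (fun q : Fin (l a.1.succ) × Fin (l a.1.castSucc) => w a.1 q.1 q.2)
      (fun r : Fin (l a.1.succ) => β a.1 r) a.2 with hval
  -- Coordinates that hold no parameter of the network receive the value 0.
  set θ : Fin D → ℝ := fun t => Function.extend (paramIndex l) val 0 (t : ℕ) with hθ
  have hbd : ∀ t, |θ t| ≤ c := by
    intro t
    by_cases ht : ∃ a, paramIndex l a = t
    · obtain ⟨a, ha⟩ := ht
      simp only [hθ]
      rw [← ha, (paramIndex_injective l).extend_apply]
      rcases a with ⟨i, ⟨r, t⟩ | r⟩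
      · exact hw _ _ _
      · exact hβ _ _
    · simp only [hθ]
      rw [Function.extend_apply' _ _ _ ht]
      simpa using hc
  have hpar : ∀ a, paramAt θ (paramIndex l a) = val a := by
    intro a
    have hlt : paramIndex l a < D :=
      ((le_paramIndex l a).2.trans_le (layerOffset_add_le l a.1)).trans_le hD
    simp only [paramAt, hlt, dif_pos, hθ]
    exact (paramIndex_injective l).extend_apply _ _ _
  refine ⟨θ, ⟨fun t => (abs_le.1 (hbd t)).1, fun t => (abs_le.1 (hbd t)).2⟩, fun i x r => ?_⟩
  unfold affineMapAt
  congr 1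
  · exact Finset.sum_congr rfl fun t _ => congrArg (· * x t) (hpar ⟨i, .inl (r, t)⟩)
  · exact hpar ⟨i, .inr r⟩

/-! ### Networks that compute clipped maxima of cones -/

theorem sum_ite_val_mul {m t : ℕ} (ht : t < m) (α : ℝ) (y : Fin m → ℝ) :
    ∑ s : Fin m, (if (s : ℕ) = t then α else 0) * y s = α * y ⟨t, ht⟩ := by
  rw [Finset.sum_eq_single ⟨t, ht⟩]
  · simp
  · intro s _ hs
    rw [if_neg fun h => hs (Fin.ext h), zero_mul]
  · simp

/-- Evaluates a weight row supported on the neurons labelled by `e`. The first hidden layer is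
labelled by triples (point, coordinate, sign), and `e` places them among its neurons. -/
theorem sum_extend_mul {A : Type*} [Fintype A] {m : ℕ} {e : A → ℕ} (he : Function.Injective e)
    (hem : ∀ a, e a < m) (g : A → ℝ) (y : Fin m → ℝ) :
    ∑ s : Fin m, Function.extend e g 0 (s : ℕ) * y s = ∑ a, g a * y ⟨e a, hem a⟩ := by
  symm
  refine Fintype.sum_of_injective (fun a => (⟨e a, hem a⟩ : Fin m))
    (fun a a' h => he (by simpa using h)) _ _ ?_ ?_
  · intro s hs
    rw [Function.extend_apply' _ _ _ fun ⟨a, ha⟩ => hs ⟨a, Fin.ext ha⟩]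
    simp
  · intro a
    simp [he.extend_apply]

theorem abs_extend_le {A : Type*} {e : A → ℕ} (he : Function.Injective e) {g : A → ℝ} {c : ℝ}
    (hc : 0 ≤ c) (hg : ∀ a, |g a| ≤ c) (t : ℕ) : |Function.extend e g 0 t| ≤ c := by
  by_cases ht : ∃ a, e a = t
  · obtain ⟨a, rfl⟩ := ht
    rw [he.extend_apply]; exact hg a
  · rw [Function.extend_apply' _ _ _ ht]; simpa using hc

/-- The maximum of `0` and the first `k` terms of a sequence. -/
def runningMax (g : ℕ → ℝ) : ℕ → ℝ
  | 0 => 0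
  | k + 1 => max (runningMax g k) (g k)

theorem le_runningMax (g : ℕ → ℝ) {j k : ℕ} (h : j < k) : g j ≤ runningMax g k := by
  induction k with
  | zero => omega
  | succ k ih =>
    rcases Nat.lt_succ_iff_lt_or_eq.1 h with h | rfl
    · exact (ih h).trans (le_max_left _ _)
    · exact le_max_right _ _

theorem runningMax_le (g : ℕ → ℝ) {y : ℝ} (hy : 0 ≤ y) (hg : ∀ j, g j ≤ y) (k : ℕ) :
    runningMax g k ≤ y := by
  induction k with
  | zero => exact hy
  | succ k ih => exact max_le ih (hg k)

theorem add_rectifier_sub (x y : ℝ) : x + rectifier (y - x) = max x y := by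
  unfold rectifier
  rcases le_total x y with h | h
  · rw [max_eq_left (by linarith), max_eq_right h]; ring
  · rw [max_eq_right (by linarith), max_eq_left h]; ring

theorem rectifier_add_rectifier_neg (x : ℝ) : rectifier x + rectifier (-x) = |x| := by
  unfold rectifier
  rcases le_total 0 x with h | h
  · rw [max_eq_left h, max_eq_right (by linarith), abs_of_nonneg h, add_zero]
  · rw [max_eq_right h, max_eq_left (by linarith), abs_of_nonpos h, zero_add]

/-- Weights of a network computing `u + max (0, maxⱼ (hⱼ - L ‖x - xⱼ‖₁))`: the first layer computes
positive and negative parts of the coordinates of `x - xⱼ`, the later hidden layers carry the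
distances `‖x - xⱼ‖₁` and update a running maximum, stored as a sum of two neurons. -/
def maxNetWeight {d n : ℕ} (e : Fin n × Fin d × Bool → ℕ) (Dep : ℕ) (L : ℝ) (i r t : ℕ) : ℝ :=
  if i = 0 then
    Function.extend e (fun a => if t = a.2.1 then (if a.2.2 then 1 else -1) else 0) 0 r
  else if i + 1 = Dep then (if t = 0 then 1 else 0) + (if t = 1 then 1 else 0)
  else if i = 1 then
    if r = 0 then 0
    else if r = 1 then Function.extend e (fun a => if (a.1 : ℕ) = 0 then -L else 0) 0 t
    else Function.extend e (fun a => if (a.1 : ℕ) + 2 = r then 1 else 0) 0 t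
  else
    if r = 0 then (if t = 0 then 1 else 0) + (if t = 1 then 1 else 0)
    else if r = 1 then (if t = 0 then -1 else 0) + (if t = 1 then -1 else 0) +
      (if t = i + 1 then (if i - 1 < n then -L else 0) else 0)
    else if t = r then 1 else 0

/-- Biases of the network with weights `maxNetWeight`. -/
def maxNetBias {d n : ℕ} (e : Fin n × Fin d × Bool → ℕ) (Dep : ℕ) (u : ℝ)
    (pt : Fin n → Fin d → ℝ) (h : Fin n → ℝ) (i r : ℕ) : ℝ :=
  if i = 0 then Function.extend e (fun a => if a.2.2 then -pt a.1 a.2.1 else pt a.1 a.2.1) 0 r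
  else if i + 1 = Dep then u
  else if r = 1 then (if hi : i - 1 < n then h ⟨i - 1, hi⟩ else 0)
  else 0

theorem abs_maxNetWeight_le {d n : ℕ} {e : Fin n × Fin d × Bool → ℕ} (he : Function.Injective e)
    (Dep : ℕ) {L c : ℝ} (hL : |L| ≤ c) (hc : 1 ≤ c) (i r t : ℕ) :
    |maxNetWeight e Dep L i r t| ≤ c := by
  have hc0 : 0 ≤ c := by linarith
  unfold maxNetWeight
  -- The indicators that are added within a row sit in different columns: here `i ≥ 2`, so `i + 1`
  -- is neither 0 nor 1. Hence no entry exceeds `max 1 |L|`.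
  split_ifs <;> try (simp; first | omega | linarith)
  all_goals
    refine abs_extend_le he hc0 (fun a => ?_) _
    split_ifs <;> (simp; linarith)

theorem abs_maxNetBias_le {d n : ℕ} {e : Fin n × Fin d × Bool → ℕ} (he : Function.Injective e)
    (Dep : ℕ) {u c : ℝ} (hu : |u| ≤ c) {pt : Fin n → Fin d → ℝ} (hpt : ∀ j i, |pt j i| ≤ c)
    {h : Fin n → ℝ} (hh : ∀ j, |h j| ≤ c) (i r : ℕ) :
    |maxNetBias e Dep u pt h i r| ≤ c := by
  have hc0 : 0 ≤ c := (abs_nonneg _).trans hu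
  unfold maxNetBias
  split_ifs
  · refine abs_extend_le he hc0 (fun a => ?_) _
    split_ifs
    · rw [abs_neg]; exact hpt _ _
    · exact hpt _ _
  · exact hu
  · exact hh _
  · simpa using hc0
  · simpa using hc0

/-- The invariant of the hidden layers of the network with weights `maxNetWeight`: the first two
neurons add up to the running maximum, the next ones carry the distances. -/
def MaxNetInvariant {m n : ℕ} (y : Fin m → ℝ) (G : ℝ) (dist : Fin n → ℝ) : Prop :=
  ∃ r q : ℝ, 0 ≤ r ∧ 0 ≤ q ∧ r + q = G ∧ (∀ h : 0 < m, y ⟨0, h⟩ = r) ∧ (∀ h : 1 < m, y ⟨1, h⟩ = q) ∧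
    ∀ (j : Fin n) (h : (j : ℕ) + 2 < m), y ⟨j + 2, h⟩ = dist j

/-- The sequence of the cones `hⱼ - L distⱼ`, continued by `0`. -/
def coneSeq {n : ℕ} (L : ℝ) (h dist : Fin n → ℝ) (k : ℕ) : ℝ :=
  if hk : k < n then h ⟨k, hk⟩ - L * dist ⟨k, hk⟩ else 0

/-- Adding the positive and negative parts over all coordinates yields the `ℓ¹` distances. The
running maximum starts as `0` plus the positive part of the first cone. -/
theorem maxNetInvariant_init {d n Dep m m' : ℕ} {e : Fin n × Fin d × Bool → ℕ}
    (he : Function.Injective e) (hem : ∀ a, e a < m) (hn : 1 ≤ n) (hDep : 2 < Dep) {L u : ℝ}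
    {pt : Fin n → Fin d → ℝ} {h : Fin n → ℝ} {x : Fin d → ℝ} {y : Fin m → ℝ}
    (hy : ∀ a, y ⟨e a, hem a⟩ = rectifier (if a.2.2 then x a.2.1 - pt a.1 a.2.1
      else -(x a.2.1 - pt a.1 a.2.1))) {y' : Fin m' → ℝ}
    (hy' : ∀ r : Fin m', y' r = rectifier (∑ t : Fin m, maxNetWeight e Dep L 1 r t * y t +
      maxNetBias e Dep u pt h 1 r)) :
    MaxNetInvariant y' (runningMax (coneSeq L h fun j => ∑ i, |x i - pt j i|) 1)
      (fun j => ∑ i, |x i - pt j i|) := by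
  have hne : ¬ (1 + 1 = Dep) := by omega
  have hdist : ∀ (j : Fin n) (α : ℝ), (∑ t : Fin m,
      Function.extend e (fun a => if (a.1 : ℕ) = j then α else 0) 0 (t : ℕ) * y t) =
      α * ∑ i, |x i - pt j i| := by
    intro j α
    rw [sum_extend_mul he hem, Fintype.sum_prod_type, Finset.sum_eq_single j]
    · simp only [if_true, ← Finset.mul_sum, hy, Fintype.sum_prod_type, Fintype.sum_bool]
      congr 1
      refine Finset.sum_congr rfl fun i _ => ?_
      simpa using rectifier_add_rectifier_neg (x i - pt j i)
    · intro j' _ hj'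
      refine Finset.sum_eq_zero fun a _ => ?_
      rw [if_neg fun hcon => hj' (Fin.ext hcon), zero_mul]
    · simp
  refine ⟨0, rectifier (h ⟨0, hn⟩ - L * ∑ i, |x i - pt ⟨0, hn⟩ i|), le_rfl, rectifier_nonneg _,
    ?_, ?_, ?_, ?_⟩
  · have hn0 : 0 < n := hn
    simp only [runningMax, coneSeq, hn0, dif_pos]
    have := add_rectifier_sub 0 (h ⟨0, hn⟩ - L * ∑ i, |x i - pt ⟨0, hn⟩ i|)
    rwa [sub_zero] at this
  · intro _
    rw [hy']
    simp [maxNetWeight, maxNetBias, hne, rectifier]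
  · intro _
    have hn0 : 0 < n := hn
    rw [hy']
    simp only [maxNetWeight, maxNetBias, hne, if_false, one_ne_zero, if_true, Nat.sub_self, hn0,
      dif_pos]
    rw [hdist ⟨0, hn⟩ (-L)]
    congr 1; ring
  · intro j _
    rw [hy']
    have h0 : ¬ ((j : ℕ) + 2 = 0) := by omega
    have h1 : ¬ ((j : ℕ) + 2 = 1) := by omega
    simp only [maxNetWeight, maxNetBias, hne, if_false, one_ne_zero, if_true, h0, h1,
      Nat.add_right_cancel_iff]
    rw [hdist j 1, add_zero, one_mul, rectifier_of_nonneg]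
    exact Finset.sum_nonneg fun i _ => abs_nonneg _

/-- This is `max x y = x + rectifier (y - x)`: neuron 0 stores the old maximum, neuron 1 the
increment. The old maximum and the distances are nonnegative, so the rectifier leaves them
unchanged. -/
theorem maxNetInvariant_step {d n Dep m m' k : ℕ} {e : Fin n × Fin d × Bool → ℕ}
    (hk : 1 ≤ k) (hDep : k + 2 < Dep) {L u : ℝ} (hm : n + 2 ≤ m)
    {pt : Fin n → Fin d → ℝ} {h dist : Fin n → ℝ} (hdist : ∀ j, 0 ≤ dist j) {y : Fin m → ℝ}
    (hy : MaxNetInvariant y (runningMax (coneSeq L h dist) k) dist) {y' : Fin m' → ℝ}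
    (hy' : ∀ r : Fin m', y' r = rectifier (∑ t : Fin m, maxNetWeight e Dep L (k + 1) r t * y t +
      maxNetBias e Dep u pt h (k + 1) r)) :
    MaxNetInvariant y' (runningMax (coneSeq L h dist) (k + 1)) dist := by
  obtain ⟨r, q, hr, hq, hrq, hyr, hyq, hyd⟩ := hy
  have hne : ¬ (k + 1 + 1 = Dep) := by omega
  have hk0 : ¬ (k + 1 = 0) := by omega
  have hk1 : ¬ (k + 1 = 1) := by omega
  refine ⟨r + q, rectifier (coneSeq L h dist k - (r + q)), by positivity, rectifier_nonneg _,
    ?_, ?_, ?_, ?_⟩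
  · rw [add_rectifier_sub, hrq]; rfl
  · intro _
    rw [hy']
    simp only [maxNetWeight, maxNetBias, hne, if_false, hk0, hk1, if_true, zero_ne_one,
      add_mul, Finset.sum_add_distrib]
    rw [sum_ite_val_mul (by omega : 0 < m), sum_ite_val_mul (by omega : 1 < m), hyr, hyq,
      rectifier_of_nonneg] <;> linarith
  · intro _
    rw [hy']
    simp only [maxNetWeight, maxNetBias, hne, if_false, hk0, hk1, if_true, one_ne_zero,
      add_mul, Finset.sum_add_distrib, Nat.add_sub_cancel]
    rw [sum_ite_val_mul (by omega : 0 < m), sum_ite_val_mul (by omega : 1 < m), hyr, hyq]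
    by_cases hkn : k < n
    · simp only [hkn, if_true, dif_pos, coneSeq]
      have := sum_ite_val_mul (by omega : k + 2 < m) (-L) y
      rw [show k + 1 + 1 = k + 2 from rfl, this, hyd ⟨k, hkn⟩]
      congr 1; ring
    -- Once all cones are used, surplus layers compare with 0, which cannot change a maximum that
    -- started at 0.
    · simp only [hkn, if_false, dif_neg, not_false_eq_true, coneSeq, ite_self, zero_mul,
        Finset.sum_const_zero]
      congr 1; ring
  · intro j _
    rw [hy']
    have h0 : ¬ ((j : ℕ) + 2 = 0) := by omega
    have h1 : ¬ ((j : ℕ) + 2 = 1) := by omega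
    have hjm : (j : ℕ) + 2 < m := by have := j.2; omega
    simp only [maxNetWeight, maxNetBias, hne, if_false, hk0, hk1, h0, h1]
    rw [sum_ite_val_mul hjm, hyd, add_zero, one_mul, rectifier_of_nonneg (hdist j)]

/-- Clipped maxima of cones are realized by sufficiently deep and wide networks. -/
theorem exists_maxNet {D Dep n : ℕ} (l : Fin (Dep + 1) → ℕ) (hout : l (Fin.last Dep) = 1)
    (hD : numParams l ≤ D) (hn : 1 ≤ n) (hDep : n + 2 ≤ Dep)
    (hw : ∀ i : Fin (Dep + 1), 0 < (i : ℕ) → (i : ℕ) < Dep → 2 * l 0 * n ≤ l i ∧ n + 2 ≤ l i)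
    {L u v c : ℝ} (hc : 1 ≤ c) (hL : |L| ≤ c) (hu : |u| ≤ c)
    {pt : Fin n → Fin (l 0) → ℝ} (hpt : ∀ j i, |pt j i| ≤ c) {h : Fin n → ℝ}
    (hh : ∀ j, |h j| ≤ c) :
    ∃ θ : Fin D → ℝ, θ ∈ Cube D (-c) c ∧ ∀ x : Fin (l 0) → ℝ,
      clippedNet θ l u v x (Fin.cast hout.symm 0) =
        clipping u v (u + runningMax (coneSeq L h fun j => ∑ i, |x i - pt j i|) (Dep - 2)) := by
  set e : Fin n × Fin (l 0) × Bool → ℕ := fun a => (Fintype.equivFin _ a : ℕ) with he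
  have hei : Function.Injective e := Fin.val_injective.comp (Equiv.injective _)
  have helt : ∀ a, e a < 2 * l 0 * n := fun a => by
    have := (Fintype.equivFin (Fin n × Fin (l 0) × Bool) a).2
    simp only [Fintype.card_prod, Fintype.card_fin, Fintype.card_bool] at this
    calc e a < n * (l 0 * 2) := this
      _ = _ := by ring
  obtain ⟨θ, hθ, haff⟩ := exists_param l hD (by linarith) (maxNetWeight e Dep L)
    (maxNetBias e Dep u pt h) (abs_maxNetWeight_le hei Dep hL hc) (abs_maxNetBias_le hei Dep hu hpt hh)
  refine ⟨θ, hθ, fun x => ?_⟩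
  set dist : Fin n → ℝ := fun j => ∑ i, |x i - pt j i| with hdist
  have hhid : ∀ (i : Fin Dep) (r : Fin (l i.succ)), (i : ℕ) + 1 < Dep →
      layerState θ l u v i.succ x r = rectifier (∑ t : Fin (l i.castSucc),
        maxNetWeight e Dep L i r t * layerState θ l u v i.castSucc x t +
        maxNetBias e Dep u pt h i r) := by
    intro i r hi
    rw [layerState_succ, if_neg hi.ne, haff]
  have hwidth : ∀ k (hk : k < Dep), 0 < k → 2 * l 0 * n ≤ l (⟨k, hk⟩ : Fin Dep).castSucc ∧
      n + 2 ≤ l (⟨k, hk⟩ : Fin Dep).castSucc := fun k hk hk0 => hw _ hk0 hk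
  have hfirst : ∀ a, layerState θ l u v (⟨1, by omega⟩ : Fin Dep).castSucc x
      ⟨e a, (helt a).trans_le (hwidth 1 (by omega) one_pos).1⟩ =
      rectifier (if a.2.2 then x a.2.1 - pt a.1 a.2.1 else -(x a.2.1 - pt a.1 a.2.1)) := by
    intro a
    refine (hhid ⟨0, by omega⟩ _ (by simp only; omega)).trans ?_
    change rectifier (∑ t : Fin (l 0), maxNetWeight e Dep L 0 (e a) t * x t +
      maxNetBias e Dep u pt h 0 (e a)) = _
    simp only [maxNetWeight, maxNetBias, if_true, hei.extend_apply]
    rw [sum_ite_val_mul a.2.1.2]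
    congr 1
    split_ifs <;> simp <;> ring
  have hinv : ∀ k, 1 ≤ k → ∀ hk : k + 1 < Dep,
      MaxNetInvariant (layerState θ l u v (⟨k, by omega⟩ : Fin Dep).succ x)
        (runningMax (coneSeq L h dist) k) dist := by
    intro k hk1
    induction k, hk1 using Nat.le_induction with
    | base =>
      intro hk
      exact maxNetInvariant_init hei _ hn hk hfirst fun r => hhid ⟨1, by omega⟩ r hk
    | succ k hk1 ih =>
      intro hk
      exact maxNetInvariant_step (y := layerState θ l u v (⟨k + 1, by omega⟩ : Fin Dep).castSucc x)
        hk1 hk (hwidth (k + 1) (by omega) (by omega)).2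
        (fun j => Finset.sum_nonneg fun i _ => abs_nonneg _) (ih (by omega))
        fun r => hhid ⟨k + 1, by omega⟩ r hk
  -- The first hidden layer and the output layer perform no update, so `Dep - 2` terms enter the
  -- maximum.
  obtain ⟨N, rfl⟩ : ∃ N, Dep = N + 2 := ⟨Dep - 2, by omega⟩
  obtain ⟨r, q, -, -, hrq, hyr, hyq, -⟩ := hinv N (by omega) (by omega)
  have hlast : layerState θ l u v (Fin.last (N + 1)).succ x (Fin.cast hout.symm 0) =
      clipping u v (∑ t : Fin (l (Fin.last (N + 1)).castSucc),
        maxNetWeight e (N + 2) L (N + 1) 0 t * layerState θ l u v (Fin.last (N + 1)).castSucc x t +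
        maxNetBias e (N + 2) u pt h (N + 1) 0) := by
    refine (layerState_succ θ l u v (Fin.last (N + 1)) x (Fin.cast hout.symm 0)).trans ?_
    rw [if_pos (by simp), haff]
    rfl
  refine hlast.trans ?_
  have hwl := (hwidth (N + 1) (by omega) (by omega)).2
  have hN0 : ¬ (N + 1 = 0) := by omega
  simp only [maxNetWeight, maxNetBias, hN0, if_false, if_true, add_mul, Finset.sum_add_distrib]
  rw [sum_ite_val_mul (lt_of_lt_of_le (by omega) hwl : 0 < l (Fin.last (N + 1)).castSucc),
    sum_ite_val_mul (lt_of_lt_of_le (by omega) hwl : 1 < l (Fin.last (N + 1)).castSucc)]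
  have e0 := hyr (lt_of_lt_of_le (by omega) hwl)
  have e1 := hyq (lt_of_lt_of_le (by omega) hwl)
  change clipping u v (1 * layerState θ l u v (⟨N, by omega⟩ : Fin (N + 2)).succ x ⟨0, _⟩ +
    1 * layerState θ l u v (⟨N, by omega⟩ : Fin (N + 2)).succ x ⟨1, _⟩ + u) = _
  rw [e0, e1, Nat.add_sub_cancel, ← hrq]
  congr 1; ring

/-- Constant functions are realized by every architecture. -/
theorem exists_constNet {D Dep : ℕ} (l : Fin (Dep + 1) → ℕ) (hout : l (Fin.last Dep) = 1)
    (hD : numParams l ≤ D) (hDep : 1 ≤ Dep) {u v c z : ℝ} (hz : z ∈ Set.Icc u v) (hzc : |z| ≤ c) :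
    ∃ θ : Fin D → ℝ, θ ∈ Cube D (-c) c ∧ ∀ x : Fin (l 0) → ℝ,
      clippedNet θ l u v x (Fin.cast hout.symm 0) = z := by
  have hc : 0 ≤ c := (abs_nonneg z).trans hzc
  obtain ⟨θ, hθ, haff⟩ := exists_param l hD hc (fun _ _ _ => 0) (fun _ _ => z)
    (by simpa using hc) (fun _ _ => hzc)
  refine ⟨θ, hθ, fun x => ?_⟩
  obtain ⟨N, rfl⟩ : ∃ N, Dep = N + 1 := ⟨Dep - 1, by omega⟩
  refine (layerState_succ θ l u v (Fin.last N) x (Fin.cast hout.symm 0)).trans ?_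
  rw [if_pos (by simp), haff]
  simp only [zero_mul, Finset.sum_const_zero, zero_add]
  rw [clipping, min_eq_left hz.2, max_eq_right hz.1]

/-! ### Approximation rate for Lipschitz functions -/

theorem minDepthWidth_le_depth {L : ℕ} (l : Fin (L + 1) → ℕ) : minDepthWidth l ≤ L :=
  Nat.sInf_le (by simp)

theorem minDepthWidth_le_width {L : ℕ} (l : Fin (L + 1) → ℕ) (i : Fin (L + 1)) (h0 : 0 < (i : ℕ))
    (h1 : (i : ℕ) < L) : minDepthWidth l ≤ l i :=
  Nat.sInf_le (Or.inr ⟨i, h0, h1, rfl⟩)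

theorem one_le_minDepthWidth {L : ℕ} (hL : 1 ≤ L) {l : Fin (L + 1) → ℕ} (hl : ∀ i, 1 ≤ l i) :
    1 ≤ minDepthWidth l := by
  have h := Nat.sInf_mem (s := {L} ∪ {m : ℕ | ∃ i : Fin (L + 1), 0 < (i : ℕ) ∧ (i : ℕ) < L ∧
    l i = m}) ⟨L, by simp⟩
  rcases h with h | ⟨i, -, -, h⟩
  · exact hL.trans_eq h.symm
  · exact (hl i).trans_eq h

theorem two_mul_le_two_pow {d : ℕ} (hd : 1 ≤ d) : 2 * d ≤ 2 ^ d := by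
  induction d, hd using Nat.le_induction with
  | base => norm_num
  | succ d hd ih => rw [pow_succ]; omega

/-- The number of grid points per axis affordable for a network of size `m > 6 ^ d`. -/
theorem exists_grid_size {d m : ℕ} (hd : 1 ≤ d) (hm : 6 ^ d < m) :
    ∃ k : ℕ, 1 ≤ k ∧ (m : ℝ) ^ (1 / (d : ℝ)) ≤ 3 * k ∧ 2 * d * k ^ d ≤ m ∧ k ^ d + 2 ≤ m := by
  have hd0 : (0 : ℝ) < d := by exact_mod_cast hd
  set z : ℝ := (m : ℝ) ^ (1 / (d : ℝ)) with hz
  have hzd : z ^ d = m := by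
    rw [hz, ← Real.rpow_natCast, ← Real.rpow_mul (Nat.cast_nonneg _), one_div_mul_cancel hd0.ne',
      Real.rpow_one]
  have hz0 : 0 ≤ z := by positivity
  have hz6 : 6 < z := by
    refine lt_of_pow_lt_pow_left₀ d hz0 ?_
    rw [hzd]; exact_mod_cast hm
  -- The witness is `⌈z / 3⌉₊`: as `z > 6`, it lies between `z / 3`, which gives the rate, and `z /
  -- 2`, which leaves the factor `2 ^ d ≥ 2 * d` for the width.
  have hk3 : 2 < ⌈z / 3⌉₊ := Nat.lt_ceil.2 (by push_cast; linarith)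
  have hkle : (⌈z / 3⌉₊ : ℝ) ≤ z / 2 := by
    have := Nat.ceil_lt_add_one (show 0 ≤ z / 3 by positivity)
    linarith
  have hpow : 2 ^ d * ⌈z / 3⌉₊ ^ d ≤ m := by
    have : ((2 : ℝ) * ⌈z / 3⌉₊) ^ d ≤ z ^ d := by gcongr; linarith
    rw [hzd, mul_pow] at this
    exact_mod_cast this
  have h2 : 2 ≤ ⌈z / 3⌉₊ ^ d := by
    calc 2 ≤ ⌈z / 3⌉₊ := by omega
      _ ≤ _ := Nat.le_self_pow (by omega) _
  have h2d := two_mul_le_two_pow hd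
  refine ⟨⌈z / 3⌉₊, by omega, ?_, (Nat.mul_le_mul_right _ h2d).trans hpow, ?_⟩
  · have := Nat.le_ceil (z / 3); linarith
  · nlinarith

theorem abs_clipping_sub_le_of_mem {u v y z : ℝ} (hz : z ∈ Set.Icc u v) :
    |clipping u v y - z| ≤ |y - z| := by
  have h : clipping u v z = z := by rw [clipping, min_eq_left hz.2, max_eq_right hz.1]
  calc _ = |clipping u v y - clipping u v z| := by rw [h]
    _ ≤ _ := abs_clipping_sub_le _ _ _ _

/-- Maxima of cones at points that are `δ`-dense approximate Lipschitz functions. -/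
theorem abs_runningMax_coneSeq_sub_le {d n : ℕ} {a b u v L δ : ℝ} (hL : 0 ≤ L)
    {f : Cube d a b → Set.Icc u v}
    (hf : ∀ x y : Cube d a b,
      |(f x : ℝ) - (f y : ℝ)| ≤ L * ∑ i, |(x : Fin d → ℝ) i - (y : Fin d → ℝ) i|)
    (pt : Fin n → Cube d a b) (x : Cube d a b)
    (hδ : ∃ j, ∑ i, |(x : Fin d → ℝ) i - (pt j : Fin d → ℝ) i| ≤ δ) {N : ℕ} (hN : n ≤ N) :
    |u + runningMax (coneSeq L (fun j => (f (pt j) : ℝ) - u)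
      (fun j => ∑ i, |(x : Fin d → ℝ) i - (pt j : Fin d → ℝ) i|)) N - f x| ≤ 2 * L * δ := by
  obtain ⟨j, hj⟩ := hδ
  have hδ0 : 0 ≤ δ := (Finset.sum_nonneg fun i _ => abs_nonneg _).trans hj
  have hfx := (f x).2.1
  -- By the Lipschitz condition every cone stays below the function. The cone at a point within `δ`
  -- loses `L * δ` from the slope and at most `L * δ` from the change of the function.
  have hup : runningMax (coneSeq L (fun j => (f (pt j) : ℝ) - u)
      (fun j => ∑ i, |(x : Fin d → ℝ) i - (pt j : Fin d → ℝ) i|)) N ≤ f x - u := by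
    refine runningMax_le _ (by linarith) (fun k => ?_) N
    unfold coneSeq
    split_ifs with hk
    · have := hf (pt ⟨k, hk⟩) x
      simp only [abs_sub_comm ((pt ⟨k, hk⟩ : Fin d → ℝ) _)] at this
      linarith [(abs_le.1 this).2]
    · linarith
  have hlow := le_runningMax (coneSeq L (fun j => (f (pt j) : ℝ) - u)
      (fun j => ∑ i, |(x : Fin d → ℝ) i - (pt j : Fin d → ℝ) i|)) (j.2.trans_le hN)
  simp only [coneSeq, j.2, dif_pos] at hlow hup ⊢
  have h1 := (abs_le.1 (hf x (pt j))).2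
  have h2 : L * ∑ i, |(x : Fin d → ℝ) i - (pt j : Fin d → ℝ) i| ≤ L * δ := by gcongr
  rw [abs_le]
  constructor <;> nlinarith

/-- The approximation error of rectified clipped networks for Lipschitz functions. -/
theorem exists_clippedNetReal_near {d D Dep : ℕ} (hd : 1 ≤ d) (hDep : 1 ≤ Dep)
    {L a u b v c : ℝ} (hab : a < b) (hc1 : 1 ≤ c) (hLc : L ≤ c) (hac : |a| ≤ c) (hbc : |b| ≤ c)
    (huc : 2 * |u| ≤ c) (hvc : 2 * |v| ≤ c) (hL : 0 ≤ L)
    (l : Fin (Dep + 1) → ℕ) (hl : ∀ i, 1 ≤ l i)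
    (hin : l 0 = d) (hout : l (Fin.last Dep) = 1) (hD : numParams l ≤ D)
    (f : Cube d a b → Set.Icc u v)
    (hf : ∀ x y : Cube d a b,
      |(f x : ℝ) - (f y : ℝ)| ≤ L * ∑ i, |(x : Fin d → ℝ) i - (y : Fin d → ℝ) i|) :
    ∃ θ : Fin D → ℝ, θ ∈ Cube D (-c) c ∧ ∀ x : Cube d a b,
      |clippedNetReal l hin hout u v θ x - f x| ≤
        3 * d * L * (b - a) / (minDepthWidth l : ℝ) ^ (1 / (d : ℝ)) := by
  subst hin
  have hm1 := one_le_minDepthWidth hDep hl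
  have hm0 : (0 : ℝ) < minDepthWidth l := by exact_mod_cast hm1
  have hmpos : 0 < (minDepthWidth l : ℝ) ^ (1 / (l 0 : ℝ)) := Real.rpow_pos_of_pos hm0 _
  have hd0 : (0 : ℝ) < l 0 := by exact_mod_cast hd
  have hdist : ∀ (x y : Cube (l 0) a b) (r : ℝ),
      (∀ i, |(x : Fin (l 0) → ℝ) i - (y : Fin (l 0) → ℝ) i| ≤ r) →
      ∑ i, |(x : Fin (l 0) → ℝ) i - (y : Fin (l 0) → ℝ) i| ≤ l 0 * r := by
    intro x y r h
    calc _ ≤ ∑ _i : Fin (l 0), r := Finset.sum_le_sum fun i _ => h i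
      _ = _ := by simp
  have habs : ∀ y ∈ Set.Icc u v, 2 * |y| ≤ c := by
    intro y hy
    have := abs_le_max_abs_abs hy.1 hy.2
    rcases le_max_iff.1 this with h | h <;> linarith
  rcases le_or_gt (minDepthWidth l) (6 ^ l 0) with hm | hm
  -- For small networks the constant with the value at the centre suffices: its error is at most `L
  -- * d * (b - a) / 2`, and `m ^ (1 / d) ≤ 6`.
  · set x₀ : Cube (l 0) a b := ⟨fun _ => (a + b) / 2, fun _ => by simp only; linarith,
      fun _ => by simp only; linarith⟩ with hx₀
    have hz := habs _ (f x₀).2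
    obtain ⟨θ, hθ, hval⟩ := exists_constNet (c := c) l hout hD hDep (f x₀).2
      (by linarith [abs_nonneg (f x₀ : ℝ)])
    refine ⟨θ, hθ, fun x => ?_⟩
    have hnet : clippedNetReal l rfl hout u v θ x = f x₀ := hval _
    rw [hnet]
    have hm6 : (minDepthWidth l : ℝ) ^ (1 / (l 0 : ℝ)) ≤ 6 := by
      calc _ ≤ ((6 : ℝ) ^ (l 0 : ℝ)) ^ (1 / (l 0 : ℝ)) := by
            gcongr
            rw [Real.rpow_natCast]
            exact_mod_cast hm
        _ = 6 := by
            rw [← Real.rpow_mul (by norm_num), mul_one_div_cancel hd0.ne', Real.rpow_one]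
    have h1 : ∑ i, |(x₀ : Fin (l 0) → ℝ) i - (x : Fin (l 0) → ℝ) i| ≤ l 0 * ((b - a) / 2) := by
      refine hdist _ _ _ fun i => ?_
      have h1 := x.2.1 i
      have h2 := x.2.2 i
      simp only at h1 h2
      simp only [hx₀]
      rw [abs_le]
      constructor <;> linarith
    have h2 := hf x₀ x
    rw [le_div_iff₀ hmpos]
    calc _ ≤ (L * (l 0 * ((b - a) / 2))) * 6 := by
          gcongr
          exact h2.trans (by gcongr)
      _ = _ := by ring
  · obtain ⟨k, hk1, hk, hkw, hkd⟩ := exists_grid_size hd hm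
    have hk0 : (0 : ℝ) < k := by exact_mod_cast hk1
    have hB : 0 < (b - a) / 2 := by linarith
    set r := (b - a) / 2 / k with hr
    have hr0 : 0 < r := by positivity
    set E := (finFunctionFinEquiv (m := k) (n := l 0)) with hE
    set pt : Fin (k ^ l 0) → Cube (l 0) a b := fun j =>
      ⟨fun i => (a + b) / 2 + (-((b - a) / 2) + (2 * ((E.symm j i : ℕ) : ℝ) + 1) * r), by
        have hkr : k * r = (b - a) / 2 := by rw [hr]; field_simp
        constructor <;> intro i <;> simp only
        · have : 0 ≤ (2 * ((E.symm j i : ℕ) : ℝ) + 1) * r := by positivity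
          linarith
        · have h1 : ((E.symm j i : ℕ) : ℝ) + 1 ≤ k := by exact_mod_cast (E.symm j i).2
          nlinarith⟩ with hpt
    have hnear : ∀ x : Cube (l 0) a b, ∃ j,
        ∑ i, |(x : Fin (l 0) → ℝ) i - (pt j : Fin (l 0) → ℝ) i| ≤ l 0 * r := by
      intro x
      have hx : ∀ i, |(x : Fin (l 0) → ℝ) i - (a + b) / 2| ≤ (b - a) / 2 := by
        intro i
        have h1 := x.2.1 i
        have h2 := x.2.2 i
        simp only at h1 h2
        rw [abs_le]
        constructor <;> linarith
      choose κ hκ using fun i => exists_grid_near hk1 hB (hx i)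
      refine ⟨E κ, hdist _ _ _ fun i => ?_⟩
      simp only [hpt, Equiv.symm_apply_apply]
      rw [← sub_sub]
      exact hκ i
    have hn1 : 1 ≤ k ^ l 0 := Nat.one_le_pow _ _ hk1
    have hdw := minDepthWidth_le_depth l
    obtain ⟨θ, hθ, hval⟩ := exists_maxNet (n := k ^ l 0) l hout hD hn1 (hkd.trans hdw)
      (fun i hi0 hi1 => ⟨hkw.trans (minDepthWidth_le_width l i hi0 hi1),
        hkd.trans (minDepthWidth_le_width l i hi0 hi1)⟩) (L := L) (u := u) (v := v) hc1
      (by rwa [abs_of_nonneg hL]) (by linarith [abs_nonneg u])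
      (pt := fun j => (pt j : Fin (l 0) → ℝ)) (fun j i =>
        (abs_le_max_abs_abs ((pt j).2.1 i) ((pt j).2.2 i)).trans (max_le hac hbc))
      -- The shift by `u` makes the target nonnegative, as a running maximum started at 0 requires.
      -- The hypotheses on `2 * |u|` and `2 * |v|` keep these biases within `c`.
      (h := fun j => (f (pt j) : ℝ) - u) (fun j => by
        have := habs _ (f (pt j)).2
        have h2 := abs_sub (f (pt j) : ℝ) u
        linarith)
    refine ⟨θ, hθ, fun x => ?_⟩
    have hnet := hval x
    change clippedNetReal l rfl hout u v θ x = _ at hnet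
    rw [hnet]
    refine (abs_clipping_sub_le_of_mem (f x).2).trans ?_
    refine (abs_runningMax_coneSeq_sub_le hL hf pt x (hnear x) (by omega)).trans ?_
    rw [le_div_iff₀ hmpos]
    calc _ ≤ 2 * L * (l 0 * r) * (3 * k) := by gcongr
      _ = _ := by rw [hr]; field_simp

/-! ### Bias-variance decomposition -/

theorem integrable_of_abs_le {Ω : Type*} [MeasurableSpace Ω] {P : Measure Ω} [IsFiniteMeasure P]
    {f : Ω → ℝ} (hf : Measurable f) {C : ℝ} (hC : ∀ ω, |f ω| ≤ C) : Integrable f P :=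
  Integrable.of_bound hf.aestronglyMeasurable C (Filter.Eventually.of_forall hC)

/-- The bias-variance decomposition of the squared loss at the regression function. -/
theorem integral_sq_sub_regression {Ω α : Type*} [MeasurableSpace Ω] [mα : MeasurableSpace α]
    (P : Measure Ω) [IsProbabilityMeasure P] {X : Ω → α} (hX : Measurable X) {Y : Ω → ℝ}
    (hY : Measurable Y) {g E : α → ℝ} (hg : Measurable g) (hE : Measurable E) {C : ℝ}
    (hYC : ∀ ω, |Y ω| ≤ C) (hgC : ∀ x, |g x| ≤ C) (hEC : ∀ x, |E x| ≤ C)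
    (hreg : (fun ω => E (X ω)) =ᵐ[P] P[Y | mα.comap X]) :
    ∫ ω, |g (X ω) - E (X ω)| ^ 2 ∂P = ∫ ω, |g (X ω) - Y ω| ^ 2 ∂P - ∫ ω, |E (X ω) - Y ω| ^ 2 ∂P := by
  have hm : mα.comap X ≤ ‹MeasurableSpace Ω› := hX.comap_le
  have hgX := hg.comp hX
  have hEX := hE.comp hX
  set h : Ω → ℝ := fun ω => g (X ω) - E (X ω) with hh
  have hhm : Measurable h := hgX.sub hEX
  have hhC : ∀ ω, |h ω| ≤ 2 * C := fun ω => by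
    refine (abs_sub _ _).trans ?_
    linarith [hgC (X ω), hEC (X ω)]
  have hhsm : StronglyMeasurable[mα.comap X] h :=
    ((hg.sub hE).comp (comap_measurable X)).stronglyMeasurable
  have hYi : Integrable Y P := integrable_of_abs_le hY hYC
  have hhY : Integrable (h * Y) P := integrable_of_abs_le (hhm.mul hY) (C := 2 * C * C) fun ω => by
    rw [Pi.mul_apply, abs_mul]
    exact mul_le_mul (hhC ω) (hYC ω) (abs_nonneg _) ((abs_nonneg _).trans (hhC ω))
  have hhE : Integrable (fun ω => h ω * E (X ω)) P :=
    integrable_of_abs_le (hhm.mul hEX) (C := 2 * C * C) fun ω => by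
      rw [abs_mul]
      exact mul_le_mul (hhC ω) (hEC _) (abs_nonneg _) ((abs_nonneg _).trans (hhC ω))
  -- `h` depends on `X` only, so it can be pulled out of the conditional expectation.
  have hcross : ∫ ω, h ω * Y ω ∂P = ∫ ω, h ω * E (X ω) ∂P := by
    have h1 := condExp_mul_of_stronglyMeasurable_left hhsm hhY hYi
    calc ∫ ω, h ω * Y ω ∂P = ∫ ω, (P[h * Y | mα.comap X]) ω ∂P := (integral_condExp hm).symm
      _ = _ := by
        refine integral_congr_ae ?_
        filter_upwards [h1, hreg] with ω h2 h3
        rw [h2, Pi.mul_apply, ← h3]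
  have hsq : ∀ {f : Ω → ℝ}, Measurable f → (∀ ω, |f ω| ≤ 2 * C) →
      Integrable (fun ω => |f ω| ^ 2) P := fun {f} hf hfC =>
    integrable_of_abs_le (hf.abs.pow_const 2) (C := (2 * C) ^ 2) fun ω => by
      rw [abs_pow, abs_abs]
      exact pow_le_pow_left₀ (abs_nonneg _) (hfC ω) 2
  have i1 := hsq hhm hhC
  have i2 : Integrable (fun ω => |E (X ω) - Y ω| ^ 2) P :=
    hsq (hEX.sub hY) fun ω => (abs_sub _ _).trans (by linarith [hEC (X ω), hYC ω])
  have hexp : (fun ω => |g (X ω) - Y ω| ^ 2) = fun ω =>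
      (|h ω| ^ 2 + |E (X ω) - Y ω| ^ 2) + 2 * (h ω * E (X ω) - h ω * Y ω) := by
    ext ω
    simp only [sq_abs, hh]
    ring
  have i3 : Integrable (fun ω => 2 * (h ω * E (X ω) - h ω * Y ω)) P := (hhE.sub hhY).const_mul 2
  rw [hexp, integral_add (Integrable.fun_add i1 i2) i3, integral_add i1 i2, integral_const_mul,
    integral_sub hhE (show Integrable (fun ω => h ω * Y ω) P from hhY), hcross]
  simp only [hh]
  ring

/-! ### Estimates of the constants -/

/-- The resolution of a grid which makes the discretization error of the risk negligible. -/
theorem exists_grid_resolution {Dep W M n : ℕ} {B c : ℝ} (hDep : 1 ≤ Dep) (hM : 1 ≤ M)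
    (hc : 1 ≤ c) (hB : 1 ≤ B) (hn : n ≤ Dep * (W * (W + 1))) :
    ∃ T : ℕ, 0 < T ∧ ((W : ℝ) + 1) ^ Dep * B ^ Dep * c * Real.sqrt M ≤ T ∧
      2 * (T : ℝ) ^ n ≤ Real.exp ((Dep : ℝ) ^ 2 * (W + 1) ^ 3 * Real.log (3 * M * B * c)) := by
  have hM' : (1 : ℝ) ≤ M := by exact_mod_cast hM
  have hsM : 1 ≤ Real.sqrt M := Real.one_le_sqrt.2 hM'
  have hW : (0 : ℝ) ≤ W := W.cast_nonneg
  set z := ((W : ℝ) + 1) ^ Dep * B ^ Dep * c * Real.sqrt M with hz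
  have hz1 : 1 ≤ z := by
    have h1 : 1 ≤ ((W : ℝ) + 1) ^ Dep := one_le_pow₀ (by linarith)
    have h2 : 1 ≤ B ^ Dep := one_le_pow₀ hB
    exact one_le_mul_of_one_le_of_one_le (one_le_mul_of_one_le_of_one_le
      (one_le_mul_of_one_le_of_one_le h1 h2) hc) hsM
  set A := 3 * M * B * c with hA
  have hMBc : 1 ≤ M * B * c :=
    one_le_mul_of_one_le_of_one_le (one_le_mul_of_one_le_of_one_le hM' hB) hc
  have hA3 : 3 ≤ A := by rw [hA]; nlinarith
  have hA1 : 1 ≤ A := by linarith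
  -- Everything is measured in powers of `A = 3 * M * B * c`; the 3 exceeds `e`, whence `W + 1 ≤ exp
  -- W ≤ A ^ W`, and also absorbs the 2 from rounding up.
  have hTA : (⌈z⌉₊ : ℝ) ≤ A ^ ((W + 1) * Dep) := by
    have h1 : (⌈z⌉₊ : ℝ) ≤ 2 * z := by
      have := Nat.ceil_lt_add_one (by linarith : 0 ≤ z); linarith
    have hMB : 0 ≤ (M : ℝ) := by linarith
    have h2 : 2 * c * Real.sqrt M ≤ (2 * M * c) ^ Dep := by
      have hs : Real.sqrt M ≤ M := by
        rw [Real.sqrt_le_left (by linarith)]; nlinarith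
      calc 2 * c * Real.sqrt M ≤ 2 * c * M := by gcongr
        _ = 2 * M * c := by ring
        _ ≤ _ := le_self_pow₀ (by nlinarith) (by omega)
    have h3 : (W : ℝ) + 1 ≤ A ^ W := by
      calc (W : ℝ) + 1 ≤ Real.exp W := Real.add_one_le_exp _
        _ = Real.exp 1 ^ W := by rw [← Real.exp_nat_mul, mul_one]
        _ ≤ A ^ W := by
          gcongr
          linarith [Real.exp_one_lt_d9]
    calc (⌈z⌉₊ : ℝ) ≤ ((W : ℝ) + 1) ^ Dep * B ^ Dep * (2 * c * Real.sqrt M) := by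
          rw [hz] at h1; linarith
      _ ≤ (A ^ W) ^ Dep * B ^ Dep * (2 * M * c) ^ Dep := by gcongr
      _ = (A ^ W * (2 * (M * B * c))) ^ Dep := by
          rw [← mul_pow, ← mul_pow]; ring
      _ ≤ (A ^ W * A) ^ Dep := by
          gcongr
          rw [hA]; linarith
      _ = _ := by rw [← pow_succ, ← pow_mul]
  refine ⟨⌈z⌉₊, Nat.ceil_pos.2 (by linarith), Nat.le_ceil _, ?_⟩
  calc 2 * (⌈z⌉₊ : ℝ) ^ n ≤ A * (A ^ ((W + 1) * Dep)) ^ n := by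
        gcongr; linarith
    _ = A ^ ((W + 1) * Dep * n + 1) := by rw [← pow_mul, pow_succ, mul_comm]
    _ ≤ A ^ (Dep ^ 2 * (W + 1) ^ 3) := by
        refine pow_le_pow_right₀ hA1 ?_
        have h1 : (W + 1) * Dep * n ≤ (W + 1) * Dep * (Dep * (W * (W + 1))) :=
          Nat.mul_le_mul_left _ hn
        have h2 : 1 ≤ Dep ^ 2 * (W + 1) ^ 2 := Nat.one_le_iff_ne_zero.2 (by positivity)
        calc _ ≤ (W + 1) * Dep * (Dep * (W * (W + 1))) + Dep ^ 2 * (W + 1) ^ 2 := by omega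
          _ = _ := by ring
    _ = _ := by
        have hAe : A = Real.exp (Real.log A) := (Real.exp_log (by linarith)).symm
        conv_lhs => rw [hAe]
        rw [← Real.exp_nat_mul]
        push_cast
        rfl

theorem sqrt_le_of_one_le_sq_mul {a x q : ℝ} (ha : 0 ≤ a) (hx : 1 ≤ x) (hq : q ≤ a ^ 2 * x) :
    Real.sqrt q ≤ a * x := by
  rw [Real.sqrt_le_left (by positivity)]
  calc q ≤ a ^ 2 * x := hq
    _ ≤ a ^ 2 * x ^ 2 := by gcongr; nlinarith
    _ = _ := by ring

theorem one_le_log_three_mul {x : ℝ} (hx : 1 ≤ x) : 1 ≤ Real.log (3 * x) := by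
  rw [Real.le_log_iff_exp_le (by linarith)]
  linarith [Real.exp_one_lt_d9]

/-- The second, simplified form of the overall error bound. -/
theorem error_bound_simplified {d Dep M K : ℕ} {W m L a u b v c B p : ℝ}
    (hDep : 1 ≤ Dep) (hM : 1 ≤ M) (hK : 1 ≤ K) (hW : 0 ≤ W) (hm : 0 ≤ m)
    (hab : a < b)
    (hc : max 1 (max L (max |a| (max |b| (max (2 * |u|) (2 * |v|))))) ≤ c) (hB : c ≤ B) :
    3 * d * L * (b - a) / m ^ (1 / (d : ℝ))
        + 2 * ((v - u) * Dep * (W + 1) ^ Dep * c ^ (Dep + 1) * max 1 (p / 2)) ^ (1 / 2 : ℝ)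
          / (K : ℝ) ^ (1 / (2 * (Dep : ℝ) * (W + 1) ^ 2))
        + 3 * max 1 (v - u) * (W + 1)
            * (Dep * max p (2 * Real.log (3 * M * B * c))) ^ (1 / 2 : ℝ)
          / (M : ℝ) ^ (1 / 4 : ℝ)
      ≤ 6 * d * c ^ 2 / m ^ (1 / (d : ℝ))
        + 2 * Dep * (W + 1) ^ Dep * c ^ (Dep + 1) * max 1 p
          / (K : ℝ) ^ (1 / (2 * (Dep : ℝ) * (W + 1) ^ 2))
        + 5 * B ^ 2 * Dep * (W + 1) * max p (Real.log (Real.exp 1 * M))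
          / (M : ℝ) ^ (1 / 4 : ℝ) := by
  simp only [max_le_iff] at hc
  obtain ⟨hc1, hLc, hac, hbc, huc, hvc⟩ := hc
  have hDep' : (1 : ℝ) ≤ Dep := by exact_mod_cast hDep
  have hM' : (1 : ℝ) ≤ M := by exact_mod_cast hM
  have hB1 : 1 ≤ B := hc1.trans hB
  have hvu : v - u ≤ c := by linarith [neg_abs_le u, le_abs_self v]
  have hba : b - a ≤ 2 * c := by linarith [neg_abs_le a, le_abs_self b]
  have h1 : 3 * d * L * (b - a) ≤ 6 * d * c ^ 2 := by
    calc 3 * d * L * (b - a) ≤ 3 * d * c * (2 * c) := by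
          gcongr
      _ = _ := by ring
  have h2 : 2 * ((v - u) * Dep * (W + 1) ^ Dep * c ^ (Dep + 1) * max 1 (p / 2)) ^ (1 / 2 : ℝ) ≤
      2 * Dep * (W + 1) ^ Dep * c ^ (Dep + 1) * max 1 p := by
    have hmax : max 1 (p / 2) ≤ max 1 p := by
      rcases le_total p 0 with h | h
      · rw [max_eq_left (by linarith), max_eq_left (by linarith)]
      · exact max_le_max le_rfl (by linarith)
    have hm1 : 1 ≤ max 1 p := le_max_left _ _
    have hcD : c ≤ c ^ (Dep + 1) := le_self_pow₀ hc1 (by omega)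
    have hWD : 1 ≤ (W + 1) ^ Dep := one_le_pow₀ (by linarith)
    rw [← Real.sqrt_eq_rpow]
    have : Real.sqrt ((v - u) * Dep * (W + 1) ^ Dep * c ^ (Dep + 1) * max 1 (p / 2)) ≤
        Dep * (W + 1) ^ Dep * c ^ (Dep + 1) * max 1 p := by
      rw [Real.sqrt_le_left (by positivity)]
      calc _ ≤ c ^ (Dep + 1) * Dep * (W + 1) ^ Dep * c ^ (Dep + 1) * max 1 p := by
            have : v - u ≤ c ^ (Dep + 1) := hvu.trans hcD
            gcongr
        _ = (Dep * (W + 1) ^ Dep * max 1 p) * (c ^ (Dep + 1)) ^ 2 := by ring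
        _ ≤ (Dep * (W + 1) ^ Dep * max 1 p) ^ 2 * (c ^ (Dep + 1)) ^ 2 := by
            gcongr
            refine le_self_pow₀ ?_ (by norm_num)
            exact one_le_mul_of_one_le_of_one_le (one_le_mul_of_one_le_of_one_le hDep' hWD) hm1
        _ = _ := by ring
    linarith
  have h3 : 3 * max 1 (v - u) * (W + 1)
        * (Dep * max p (2 * Real.log (3 * M * B * c))) ^ (1 / 2 : ℝ) ≤
      5 * B ^ 2 * Dep * (W + 1) * max p (Real.log (Real.exp 1 * M)) := by
    have hlogM : 0 ≤ Real.log M := Real.log_nonneg hM'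
    have hlog : Real.log (Real.exp 1 * M) = 1 + Real.log M := by
      rw [Real.log_mul (Real.exp_pos 1).ne' (by positivity), Real.log_exp]
    set y := max p (Real.log (Real.exp 1 * M)) with hy
    have hy1 : 1 + Real.log M ≤ y := hlog ▸ le_max_right _ _
    have hmaxc : max 1 (v - u) ≤ B := max_le hB1 (hvu.trans hB)
    -- The factor `5 / 3` is the target 5 divided by the leading 3. At `M = B = 1` the estimate
    -- below needs `2 * 1.2 ≤ 25 / 9`, which is why `log 3` is bounded by `1.2`.
    have key : max p (2 * Real.log (3 * M * B * c)) ≤ (5 / 3 * B * y) ^ 2 := by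
      have hB2 : 1 ≤ B ^ 2 := one_le_pow₀ hB1
      have hy2 : y ≤ y ^ 2 := by nlinarith
      apply max_le
      · calc p ≤ y := le_max_left _ _
          _ ≤ y ^ 2 := hy2
          _ ≤ (5 / 3 * B * y) ^ 2 := by nlinarith [sq_nonneg y]
      · have hl3 : Real.log 3 ≤ 1.2 := by
          rw [Real.log_le_iff_le_exp (by norm_num)]
          have h12 : Real.exp 1.2 = Real.exp 1 * Real.exp 0.2 := by
            rw [← Real.exp_add]; norm_num
          have := Real.add_one_le_exp (0.2 : ℝ)
          have := Real.exp_one_gt_d9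
          rw [h12]
          nlinarith
        have hlB : Real.log (B ^ 2) ≤ B ^ 2 - 1 := Real.log_le_sub_one_of_pos (by positivity)
        have hle : Real.log (3 * M * B * c) ≤ Real.log 3 + Real.log M + Real.log (B ^ 2) := by
          rw [← Real.log_mul (by norm_num) (by positivity), ← Real.log_mul (by positivity)
            (by positivity)]
          apply Real.log_le_log (by positivity)
          calc 3 * M * B * c ≤ 3 * M * B * B := by gcongr
            _ = _ := by ring
        have hsq : (1 + Real.log M) ^ 2 ≤ y ^ 2 := by gcongr
        have hBy : B ^ 2 * (1 + Real.log M) ^ 2 ≤ B ^ 2 * y ^ 2 := by gcongr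
        nlinarith [mul_nonneg (sub_nonneg.2 hB2) hlogM, mul_nonneg (sq_nonneg B)
          (sq_nonneg (Real.log M))]
    rw [← Real.sqrt_eq_rpow]
    have hs : Real.sqrt (Dep * max p (2 * Real.log (3 * M * B * c))) ≤ Dep * (5 / 3 * B * y) := by
      have hy0 : 0 ≤ y := by linarith
      rw [Real.sqrt_le_left (by positivity)]
      calc _ ≤ Dep * (5 / 3 * B * y) ^ 2 := by gcongr
        _ ≤ (Dep : ℝ) ^ 2 * (5 / 3 * B * y) ^ 2 := by
            gcongr
            exact le_self_pow₀ hDep' (by norm_num)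
        _ = _ := by ring
    calc _ ≤ 3 * B * (W + 1) * (Dep * (5 / 3 * B * y)) := by gcongr
      _ = _ := by ring
  gcongr

/-! ### Assembling the approximation, optimization and generalization errors -/

theorem abs_sq_loss_sub_le {u v y z w : ℝ} (hy : y ∈ Set.Icc u v) (hz : z ∈ Set.Icc u v)
    (hw : w ∈ Set.Icc u v) : |(|y - w| ^ 2) - |z - w| ^ 2| ≤ 2 * (v - u) * |y - z| := by
  rw [sq_abs, sq_abs, show (y - w) ^ 2 - (z - w) ^ 2 = (y + z - 2 * w) * (y - z) by ring, abs_mul]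
  gcongr
  rw [abs_le]
  constructor <;> linarith [hy.1, hy.2, hz.1, hz.2, hw.1, hw.2]

theorem sq_loss_mem {u v y w : ℝ} (hy : y ∈ Set.Icc u v) (hw : w ∈ Set.Icc u v) :
    |y - w| ^ 2 ∈ Set.Icc 0 ((v - u) ^ 2) := by
  refine ⟨by positivity, ?_⟩
  rw [sq_abs]
  have h : |y - w| ≤ v - u := by
    rw [abs_le]
    constructor <;> linarith [hy.1, hy.2, hw.1, hw.2]
  exact sq_le_sq' (by linarith [(abs_le.1 h).1]) (abs_le.1 h).2

/-- Enlarging the exponent from `p / 2` to `q ≥ 1` makes Minkowski's inequality available even for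
`p < 2`. The outer power is the square root of the `L^{p/2}` norm of `Q`, and the square root is
subadditive. -/
theorem integral_rpow_le_of_error_decomposition {Ω : Type*} [MeasurableSpace Ω] (P : Measure Ω)
    [IsProbabilityMeasure P] {Q ρ G : Ω → ℝ} (hQm : Measurable Q) (hρm : Measurable ρ)
    (hGm : Measurable G) (hQ0 : ∀ ω, 0 ≤ Q ω) {e α τ rρ rG p q : ℝ} (he : 0 ≤ e) (hα : 0 ≤ α)
    (hτ : 0 ≤ τ) (hrρ : 0 ≤ rρ) (hrG : 0 ≤ rG)
    (hQ : ∀ᵐ ω ∂P, Q ω ≤ e ^ 2 + α * ρ ω + 2 * (G ω + τ))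
    (hp : 0 < p) (hq : 1 ≤ q) (hpq : p / 2 ≤ q)
    (hρ : eLpNorm ρ (ENNReal.ofReal q) P ≤ ENNReal.ofReal rρ)
    (hG : eLpNorm G (ENNReal.ofReal q) P ≤ ENNReal.ofReal rG)
    (hint : Integrable (fun ω => Q ω ^ (p / 2)) P) :
    (∫ ω, Q ω ^ (p / 2) ∂P) ^ (1 / p) ≤ e + Real.sqrt (α * rρ) + Real.sqrt (2 * (rG + τ)) := by
  have hq1 : 1 ≤ ENNReal.ofReal q := by rwa [ENNReal.one_le_ofReal]
  have hne : ENNReal.ofReal q ≠ 0 := (zero_lt_one.trans_le hq1).ne'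
  have hnorm : eLpNorm Q (ENNReal.ofReal (p / 2)) P ≤
      ENNReal.ofReal (e ^ 2 + α * rρ + 2 * (rG + τ)) := by
    calc eLpNorm Q (ENNReal.ofReal (p / 2)) P ≤ eLpNorm Q (ENNReal.ofReal q) P :=
          eLpNorm_le_eLpNorm_of_exponent_le (ENNReal.ofReal_le_ofReal hpq) hQm.aestronglyMeasurable
      _ ≤ eLpNorm ((fun _ => e ^ 2 + 2 * τ) + ((α • ρ) + ((2 : ℝ) • G))) (ENNReal.ofReal q) P := by
          refine eLpNorm_mono_ae_real ?_
          filter_upwards [hQ] with ω h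
          rw [Real.norm_eq_abs, abs_of_nonneg (hQ0 ω)]
          simp only [Pi.add_apply, Pi.smul_apply, smul_eq_mul]
          linarith
      _ ≤ eLpNorm (fun _ => e ^ 2 + 2 * τ) (ENNReal.ofReal q) P +
          (eLpNorm (α • ρ) (ENNReal.ofReal q) P + eLpNorm ((2 : ℝ) • G) (ENNReal.ofReal q) P) := by
          refine (eLpNorm_add_le (by fun_prop) ?_ hq1).trans ?_
          · exact ((hρm.const_smul α).add (hGm.const_smul (2 : ℝ))).aestronglyMeasurable
          · gcongr
            exact eLpNorm_add_le (hρm.const_smul α).aestronglyMeasurable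
              (hGm.const_smul (2 : ℝ)).aestronglyMeasurable hq1
      _ ≤ ENNReal.ofReal (e ^ 2 + 2 * τ) + (ENNReal.ofReal α * ENNReal.ofReal rρ +
          ENNReal.ofReal 2 * ENNReal.ofReal rG) := by
          rw [eLpNorm_const _ hne (IsProbabilityMeasure.ne_zero P), measure_univ,
            ENNReal.one_rpow, mul_one, eLpNorm_const_smul, eLpNorm_const_smul,
            Real.enorm_eq_ofReal (by positivity), Real.enorm_eq_ofReal hα,
            Real.enorm_eq_ofReal zero_le_two]
          gcongr
      _ = _ := by
          rw [← ENNReal.ofReal_mul hα, ← ENNReal.ofReal_mul zero_le_two,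
            ← ENNReal.ofReal_add (by positivity) (by positivity),
            ← ENNReal.ofReal_add (by positivity) (by positivity)]
          congr 1; ring
  rw [eLpNorm_ofReal_eq P hQ0 (by positivity), ← ofReal_integral_eq_lintegral_ofReal hint
    (Filter.Eventually.of_forall fun ω => Real.rpow_nonneg (hQ0 ω) _)] at hnorm
  have hI0 : 0 ≤ ∫ ω, Q ω ^ (p / 2) ∂P := integral_nonneg fun ω => Real.rpow_nonneg (hQ0 ω) _
  rw [ENNReal.ofReal_rpow_of_nonneg hI0 (by positivity),
    ENNReal.ofReal_le_ofReal_iff (by positivity)] at hnorm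
  set I := ∫ ω, Q ω ^ (p / 2) ∂P
  have hroot : I ^ (1 / p) = Real.sqrt (I ^ (1 / (p / 2))) := by
    rw [Real.sqrt_eq_rpow, ← Real.rpow_mul hI0]
    congr 1; field_simp
  rw [hroot, Real.sqrt_le_left (by positivity)]
  have h1 := Real.sq_sqrt (show 0 ≤ α * rρ by positivity)
  have h2 := Real.sq_sqrt (show 0 ≤ 2 * (rG + τ) by positivity)
  have h3 := Real.sqrt_nonneg (α * rρ)
  have h4 := Real.sqrt_nonneg (2 * (rG + τ))
  generalize Real.sqrt (α * rρ) = s at *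
  generalize Real.sqrt (2 * (rG + τ)) = t at *
  nlinarith [mul_nonneg he h3, mul_nonneg he h4, mul_nonneg h3 h4]

theorem ae_mem_of_isUniform {Ω : Type*} [MeasurableSpace Ω] {P : Measure Ω} {D : ℕ}
    {s : Set (Fin D → ℝ)} (hs : MeasurableSet s) {Z : Ω → Fin D → ℝ} (hZ : Measurable Z)
    (hunif : pdf.IsUniform Z s P volume) : ∀ᵐ ω ∂P, Z ω ∈ s := by
  rw [ae_iff]
  have : {ω | Z ω ∉ s} = Z ⁻¹' sᶜ := rfl
  rw [this, ← Measure.map_apply hZ hs.compl, hunif, cond_apply hs]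
  simp

theorem measurable_squared_loss {d D Dep : ℕ} {a b u v : ℝ} {l : Fin (Dep + 1) → ℕ}
    (hin : l 0 = d) (hout : l (Fin.last Dep) = 1) (θ : Fin D → ℝ) :
    Measurable fun s : Cube d a b × Set.Icc u v =>
      |clippedNetReal l hin hout u v θ s.1 - (s.2 : ℝ)| ^ 2 := by
  have h : Continuous fun s : Cube d a b × Set.Icc u v =>
      clippedNetReal l hin hout u v θ s.1 :=
    (continuous_clippedNetReal hin hout u v).comp
      (continuous_const.prodMk (continuous_subtype_val.comp continuous_fst))
  exact (((h.sub (continuous_subtype_val.comp continuous_snd)).abs).pow 2).measurable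

/-- The generalization error of rectified clipped networks with respect to the squared loss. -/
theorem exists_generalization_bound {d D Dep M : ℕ} (hDep : 1 ≤ Dep) (hM : 1 ≤ M)
    {a u b v c B : ℝ} (huv : u < v) (hc1 : 1 ≤ c) (hac : |a| ≤ c) (hbc : |b| ≤ c) (hB : c ≤ B)
    {l : Fin (Dep + 1) → ℕ} (hl : ∀ i, 1 ≤ l i)
    (hin : l 0 = d) (hout : l (Fin.last Dep) = 1)
    {Ω : Type*} [MeasurableSpace Ω] (P : Measure Ω) [IsProbabilityMeasure P]
    {X : ℕ → Ω → Cube d a b} {Y : ℕ → Ω → Set.Icc u v}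
    (hX : ∀ j ∈ Set.Icc 1 M, Measurable (X j)) (hY : ∀ j ∈ Set.Icc 1 M, Measurable (Y j))
    (hXYindep : iIndepFun (fun (j : Set.Icc 1 M) ω => (X j ω, Y j ω)) P)
    (hXYident : ∀ j ∈ Set.Icc 1 M,
      IdentDistrib (fun ω => (X j ω, Y j ω)) (fun ω => (X 1 ω, Y 1 ω)) P P)
    {q : ℝ} (hq : 1 ≤ q) :
    ∃ (G : Ω → ℝ) (r τ : ℝ), Measurable G ∧ 0 ≤ r ∧ 0 ≤ τ ∧
      (∀ θ : Fin D → ℝ, (∀ i, |θ i| ≤ B) → ∀ ω,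
        |(1 / (M : ℝ)) * ∑ j ∈ Finset.Icc 1 M,
            |clippedNetReal l hin hout u v θ (X j ω) - (Y j ω : ℝ)| ^ 2
          - ∫ ω, |clippedNetReal l hin hout u v θ (X 1 ω) - (Y 1 ω : ℝ)| ^ 2 ∂P| ≤ G ω + τ) ∧
      eLpNorm G (ENNReal.ofReal q) P ≤ ENNReal.ofReal r ∧
      2 * (r + τ) ≤ (3 * max 1 (v - u) * ((maxWidth l : ℝ) + 1)) ^ 2 *
        (Dep * max (2 * q) (2 * Real.log (3 * M * B * c))) / Real.sqrt M := by
  have hB1 : 1 ≤ B := hc1.trans hB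
  have h1M : (1 : ℕ) ∈ Set.Icc 1 M := ⟨le_rfl, hM⟩
  have hM' : (1 : ℝ) ≤ M := by exact_mod_cast hM
  have hDep' : (1 : ℝ) ≤ Dep := by exact_mod_cast hDep
  have hMBc : 1 ≤ M * B * c :=
    one_le_mul_of_one_le_of_one_le (one_le_mul_of_one_le_of_one_le hM' hB1) hc1
  have hlog := one_le_log_three_mul hMBc
  rw [← mul_assoc, ← mul_assoc] at hlog
  obtain ⟨T, hT0, hTz, hTe⟩ := exists_grid_resolution hDep hM hc1 hB1 (numParams_le l)
  have hT0' : (0 : ℝ) < T := by exact_mod_cast hT0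
  have hW1 : (1 : ℝ) ≤ maxWidth l := by exact_mod_cast (hl 0).trans (le_maxWidth l 0)
  have : Nonempty (Set.Icc 1 M) := ⟨⟨1, h1M⟩⟩
  have hcard : Fintype.card (Set.Icc 1 M) = M := by simp
  set w : ℝ := (maxWidth l : ℝ) with hw
  set Λ : ℝ := 2 * (v - u) * (Dep * c * (w + 1) ^ Dep * B ^ (Dep - 1)) with hΛdef
  set A := Real.log (3 * M * B * c) with hA
  -- The maximal inequality needs an exponent at least the logarithm of twice the number of grid
  -- points; the `L^q` bound then follows by monotonicity of the norms.
  set q' : ℝ := max q ((Dep : ℝ) ^ 2 * (w + 1) ^ 3 * A) with hq'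
  have huv' : 0 < v - u := by linarith
  obtain ⟨G, hGm, hG0, hGdev, hGn⟩ := exists_uniform_deviation_bound (D := D) (n := numParams l)
    (T := T) P
    (ξ := fun (j : Set.Icc 1 M) ω => (X j ω, Y j ω)) (ξ₀ := fun ω => (X 1 ω, Y 1 ω))
    (fun j => (hX j j.2).prodMk (hY j j.2)) ((hX 1 h1M).prodMk (hY 1 h1M)) hXYindep
    (fun j => hXYident j j.2) hT0
    (ψ := fun θ s => |clippedNetReal l hin hout u v θ s.1 - (s.2 : ℝ)| ^ 2)
    (fun θ => measurable_squared_loss hin hout θ) (A := (v - u) ^ 2) (B := B) (Λ := Λ)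
    (by positivity) (by linarith)
    (fun θ s => sq_loss_mem (clippedNetReal_mem hDep hin hout huv.le θ _) s.2.2)
    (fun θ ϑ hθ hϑ δ hδ hclose s => by
      refine (abs_sq_loss_sub_le (clippedNetReal_mem hDep hin hout huv.le θ _)
        (clippedNetReal_mem hDep hin hout huv.le ϑ _) s.2.2).trans ?_
      have := abs_clippedNetReal_sub_le (u := u) (v := v) hin hout hB1 hc1 hδ hθ hϑ hclose
        (x := s.1) fun j => (abs_le_max_abs_abs (s.1.2.1 j) (s.1.2.2 j)).trans (max_le hac hbc)
      rw [hΛdef, mul_assoc (2 * (v - u))]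
      gcongr)
    (q := q') (hq.trans (le_max_left _ _))
    (hTe.trans (Real.exp_le_exp.2 (le_max_right _ _)))
  rw [hcard] at hGn
  have hsM : 0 < Real.sqrt M := Real.sqrt_pos.2 (by linarith)
  have hBT : 0 ≤ B / T := by positivity
  have hΛ0 : 0 ≤ Λ := by rw [hΛdef]; positivity
  refine ⟨G, (v - u) ^ 2 / (2 * Real.sqrt M) * Real.sqrt q' * Real.exp (1 / 2), 2 * (Λ * (B / T)),
    hGm, by positivity, by positivity, ?_, ?_, ?_⟩
  · intro θ hθ ω
    have := hGdev θ hθ ω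
    rw [hcard] at this
    rwa [Finset.sum_subtype (p := fun j => j ∈ Set.Icc 1 M) (Finset.Icc 1 M) (by simp)
      (fun j => |clippedNetReal l hin hout u v θ (X j ω) - (Y j ω : ℝ)| ^ 2)]
  · exact (eLpNorm_le_eLpNorm_of_exponent_le (ENNReal.ofReal_le_ofReal (le_max_left _ _))
      hGm.aestronglyMeasurable).trans hGn
  · set m := max q A with hm
    have hm1 : 1 ≤ m := hq.trans (le_max_left _ _)
    set V := max 1 (v - u) with hV
    have hV1 : 1 ≤ V := le_max_left _ _
    have hVuv : v - u ≤ V := le_max_right _ _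
    have hsq : Real.sqrt q' ≤ (Dep * (w + 1) ^ 2) * m := by
      refine sqrt_le_of_one_le_sq_mul (by positivity) hm1 (max_le ?_ ?_)
      · calc q ≤ m := le_max_left _ _
          _ ≤ _ := by
            refine le_mul_of_one_le_left (by linarith) (one_le_pow₀ ?_)
            exact one_le_mul_of_one_le_of_one_le hDep' (one_le_pow₀ (by linarith))
      · calc (Dep : ℝ) ^ 2 * (w + 1) ^ 3 * A ≤ (Dep : ℝ) ^ 2 * (w + 1) ^ 4 * m := by
              gcongr
              · linarith
              · norm_num
              · exact le_max_right _ _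
          _ = _ := by ring
    have hexp : Real.exp (1 / 2) ≤ 2 := by
      have h1 : Real.exp (1 / 2) * Real.exp (1 / 2) = Real.exp 1 := by
        rw [← Real.exp_add]; norm_num
      have := Real.exp_one_lt_d9
      nlinarith [Real.exp_pos (1 / 2)]
    have hr : (v - u) ^ 2 / (2 * Real.sqrt M) * Real.sqrt q' * Real.exp (1 / 2) ≤
        V ^ 2 * (w + 1) ^ 2 * Dep * m / Real.sqrt M := by
      calc _ ≤ V ^ 2 / (2 * Real.sqrt M) * ((Dep * (w + 1) ^ 2) * m) * 2 := by gcongr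
        _ = _ := by field_simp
    -- The resolution `T` was chosen to cancel the Lipschitz constant and leave `1 / √M`; `4 ≤ (w +
    -- 1) ^ 2` absorbs the remaining 4.
    have hτ : 2 * (Λ * (B / T)) ≤ V ^ 2 * (w + 1) ^ 2 * Dep * m / Real.sqrt M := by
      have hBpow : B ^ (Dep - 1) * B = B ^ Dep := by
        rw [← pow_succ, Nat.sub_add_cancel hDep]
      have hz0 : 0 < (w + 1) ^ Dep * B ^ Dep * c * Real.sqrt M := by positivity
      calc 2 * (Λ * (B / T)) = 4 * (v - u) * Dep * ((w + 1) ^ Dep * (B ^ (Dep - 1) * B) * c) / T := by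
            rw [hΛdef]; ring
        _ = 4 * (v - u) * Dep * ((w + 1) ^ Dep * B ^ Dep * c) / T := by rw [hBpow]
        _ ≤ 4 * (v - u) * Dep * ((w + 1) ^ Dep * B ^ Dep * c) /
            ((w + 1) ^ Dep * B ^ Dep * c * Real.sqrt M) := by gcongr
        _ = 4 * (v - u) * Dep / Real.sqrt M := by field_simp
        _ ≤ _ := by
            gcongr ?_ / _
            have h4 : 4 ≤ (w + 1) ^ 2 := by nlinarith
            have hV2 : v - u ≤ V ^ 2 := by nlinarith
            calc 4 * (v - u) * Dep ≤ (w + 1) ^ 2 * V ^ 2 * Dep := by gcongr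
              _ = V ^ 2 * (w + 1) ^ 2 * Dep := by ring
              _ ≤ _ := le_mul_of_one_le_right (by positivity) hm1
    have hmm : max (2 * q) (2 * A) = 2 * m := (mul_max_of_nonneg q A zero_le_two).symm
    rw [hmm]
    calc _ ≤ 2 * (V ^ 2 * (w + 1) ^ 2 * Dep * m / Real.sqrt M +
          V ^ 2 * (w + 1) ^ 2 * Dep * m / Real.sqrt M) := by gcongr
      _ = 4 * (V ^ 2 * (w + 1) ^ 2 * Dep * m / Real.sqrt M) := by ring
      _ ≤ 18 * (V ^ 2 * (w + 1) ^ 2 * Dep * m / Real.sqrt M) := by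
          gcongr
          norm_num
      _ = _ := by ring

/-- Opposite corners of the cube have positive distance, which excludes a negative constant. -/
theorem nonneg_of_lipschitz_cube {d : ℕ} (hd : 1 ≤ d) {a b L : ℝ} (hab : a < b)
    {f : Cube d a b → ℝ}
    (hf : ∀ x y : Cube d a b,
      |f x - f y| ≤ L * ∑ i, |(x : Fin d → ℝ) i - (y : Fin d → ℝ) i|) : 0 ≤ L := by
  have h := (abs_nonneg _).trans (hf ⟨fun _ => b, fun _ => hab.le, fun _ => le_rfl⟩
    ⟨fun _ => a, fun _ => le_rfl, fun _ => hab.le⟩)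
  simp only [Finset.sum_const, Finset.card_univ, Fintype.card_fin, nsmul_eq_mul] at h
  have hd' : (0 : ℝ) < d := by exact_mod_cast hd
  have hba : 0 < |b - a| := abs_pos.2 (by linarith)
  exact nonneg_of_mul_nonneg_left h (by positivity)

theorem continuous_of_lipschitz_cube {d : ℕ} {a b L : ℝ} {f : Cube d a b → ℝ}
    (hf : ∀ x y : Cube d a b,
      |f x - f y| ≤ L * ∑ i, |(x : Fin d → ℝ) i - (y : Fin d → ℝ) i|) : Continuous f := by
  refine continuous_iff_continuousAt.2 fun x => ?_
  rw [ContinuousAt, tendsto_iff_dist_tendsto_zero]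
  have hc : Continuous fun y : Cube d a b =>
      L * ∑ i, |(y : Fin d → ℝ) i - (x : Fin d → ℝ) i| :=
    continuous_const.mul (continuous_finsetSum _ fun i _ =>
      (((continuous_apply i).comp continuous_subtype_val).sub continuous_const).abs)
  have h0 := hc.tendsto x
  simp only [sub_self, abs_zero, Finset.sum_const_zero, mul_zero] at h0
  exact squeeze_zero (fun _ => dist_nonneg) (fun y => by rw [Real.dist_eq]; exact hf y x) h0

/-- The square root halves the exponent `1 / n`, and `n ≤ Dep * (w + 1) ^ 2` replaces it by the
stated one since `K ≥ 1`. -/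
theorem optimization_rate_le {Dep K n : ℕ} {w H : ℝ} (hK : 1 ≤ K) (hn : 1 ≤ n) (hw : 0 ≤ w)
    (hDep : 1 ≤ Dep) (hnw : (n : ℝ) ≤ Dep * (w + 1) ^ 2) (hH : 0 ≤ H) :
    Real.sqrt (4 * H * (K : ℝ) ^ (-(1 / (n : ℝ)))) ≤
      2 * H ^ (1 / 2 : ℝ) / (K : ℝ) ^ (1 / (2 * (Dep : ℝ) * (w + 1) ^ 2)) := by
  have hK' : (1 : ℝ) ≤ K := by exact_mod_cast hK
  have hK0 : (0 : ℝ) < K := by linarith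
  have hn' : (0 : ℝ) < n := by exact_mod_cast hn
  rw [← Real.sqrt_eq_rpow, Real.sqrt_le_left (by positivity), div_pow, mul_pow, Real.sq_sqrt hH,
    ← Real.rpow_natCast ((K : ℝ) ^ _), ← Real.rpow_mul hK0.le, Real.rpow_neg hK0.le,
    ← div_eq_mul_inv]
  norm_num only
  have : 1 / (2 * (Dep : ℝ) * (w + 1) ^ 2) * 2 ≤ 1 / n := by
    have hD : (0 : ℝ) < Dep * (w + 1) ^ 2 := hn'.trans_le hnw
    calc _ = 1 / (Dep * (w + 1) ^ 2) := by field_simp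
      _ ≤ _ := one_div_le_one_div_of_le hn' hnw
  gcongr

theorem sqrt_sq_mul_div_sqrt {x y z : ℝ} (hx : 0 ≤ x) (hz : 0 ≤ z) :
    Real.sqrt (x ^ 2 * y / Real.sqrt z) = x * y ^ (1 / 2 : ℝ) / z ^ (1 / 4 : ℝ) := by
  rw [Real.sqrt_div' _ (Real.sqrt_nonneg _), Real.sqrt_mul (sq_nonneg x), Real.sqrt_sq hx,
    Real.sqrt_eq_rpow y, Real.sqrt_eq_rpow z, Real.sqrt_eq_rpow, ← Real.rpow_mul hz]
  norm_num

end

theorem corollary5p7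
    (d D Dep M K N : ℕ) (hd : 1 ≤ d) (hD : 1 ≤ D) (hDep : 1 ≤ Dep) (hM : 1 ≤ M) (hK : 1 ≤ K)
    (hN : 1 ≤ N)
    (L a u b v c B : ℝ) (hab : a < b) (huv : u < v)
    (hc : max 1 (max L (max |a| (max |b| (max (2 * |u|) (2 * |v|))))) ≤ c) (hB : c ≤ B)
    (l : Fin (Dep + 1) → ℕ) (hl : ∀ i, 1 ≤ l i)
    (S : Set ℕ) (hSN : ∀ n ∈ S, n ≤ N) (hS0 : 0 ∈ S)
    (hl0 : l 0 = d) (hlDep : l (Fin.last Dep) = 1) (hDl : numParams l ≤ D)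
    {Ω : Type*} [MeasurableSpace Ω] (P : Measure Ω) [IsProbabilityMeasure P]
    (X : ℕ → Ω → Cube d a b) (Y : ℕ → Ω → Set.Icc u v)
    (hX : ∀ j ∈ Set.Icc 1 M, Measurable (X j)) (hY : ∀ j ∈ Set.Icc 1 M, Measurable (Y j))
    (hXYindep : iIndepFun (fun (j : Set.Icc 1 M) ω => (X j ω, Y j ω)) P)
    (hXYident : ∀ j ∈ Set.Icc 1 M,
      IdentDistrib (fun ω => (X j ω, Y j ω)) (fun ω => (X 1 ω, Y 1 ω)) P P)
    (E : Cube d a b → Set.Icc u v)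
    (hE : (fun ω => (E (X 1 ω) : ℝ)) =ᵐ[P]
      P[fun ω => (Y 1 ω : ℝ) | MeasurableSpace.comap (X 1) inferInstance])
    (hELip : ∀ x y : Cube d a b,
      |(E x : ℝ) - (E y : ℝ)| ≤ L * ∑ i, |(x : Fin d → ℝ) i - (y : Fin d → ℝ) i|)
    (Θ : ℕ → ℕ → Ω → (Fin D → ℝ)) (hΘ : ∀ k n, Measurable (Θ k n))
    (κ : Ω → ℕ × ℕ) (hκ : Measurable κ)
    (hΘB : ∀ k, 1 ≤ k → ∀ ω, Θ k 0 ω ∈ Cube D (-B) B)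
    (hΘindep : iIndepFun (fun (k : Set.Icc 1 K) => Θ k 0) P)
    (hΘident : ∀ k ∈ Set.Icc 1 K, IdentDistrib (Θ k 0) (Θ 1 0) P P)
    (hΘunif : pdf.IsUniform (Θ 1 0) (Cube D (-c) c) P volume)
    (R : (Fin D → ℝ) → Ω → ℝ)
    (hR : ∀ θ ω, R θ ω = (1 / (M : ℝ)) * ∑ j ∈ Finset.Icc 1 M,
      |clippedNetReal l hl0 hlDep u v θ (X j ω) - (Y j ω : ℝ)| ^ 2)
    (hκmem : ∀ ω, κ ω ∈
      {q : ℕ × ℕ | q.1 ∈ Set.Icc 1 K ∧ q.2 ∈ S ∧ ‖Θ q.1 q.2 ω‖ ≤ B})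
    (hκmin : ∀ ω, IsMinOn (fun q : ℕ × ℕ => R (Θ q.1 q.2 ω) ω)
      {q : ℕ × ℕ | q.1 ∈ Set.Icc 1 K ∧ q.2 ∈ S ∧ ‖Θ q.1 q.2 ω‖ ≤ B} (κ ω))
    (p : ℝ) (hp : 0 < p) :
    -- the integrals below are integrals of integrable functions
    (∀ ω, Integrable (fun x : Cube d a b =>
      |clippedNetReal l hl0 hlDep u v (Θ (κ ω).1 (κ ω).2 ω) x - (E x : ℝ)| ^ 2) (P.map (X 1))) ∧
    Integrable (fun ω => (∫ x : Cube d a b,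
      |clippedNetReal l hl0 hlDep u v (Θ (κ ω).1 (κ ω).2 ω) x - (E x : ℝ)| ^ 2
        ∂(P.map (X 1))) ^ (p / 2)) P ∧
    (∫ ω, (∫ x : Cube d a b,
      |clippedNetReal l hl0 hlDep u v (Θ (κ ω).1 (κ ω).2 ω) x - (E x : ℝ)| ^ 2
        ∂(P.map (X 1))) ^ (p / 2) ∂P) ^ (1 / p)
      ≤ 3 * d * L * (b - a) / (minDepthWidth l : ℝ) ^ (1 / (d : ℝ))
        + 2 * ((v - u) * Dep * ((maxWidth l : ℝ) + 1) ^ Dep * c ^ (Dep + 1) * max 1 (p / 2))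
            ^ (1 / 2 : ℝ)
          / (K : ℝ) ^ (1 / (2 * (Dep : ℝ) * ((maxWidth l : ℝ) + 1) ^ 2))
        + 3 * max 1 (v - u) * ((maxWidth l : ℝ) + 1)
            * (Dep * max p (2 * Real.log (3 * M * B * c))) ^ (1 / 2 : ℝ)
          / (M : ℝ) ^ (1 / 4 : ℝ) ∧
    3 * d * L * (b - a) / (minDepthWidth l : ℝ) ^ (1 / (d : ℝ))
        + 2 * ((v - u) * Dep * ((maxWidth l : ℝ) + 1) ^ Dep * c ^ (Dep + 1) * max 1 (p / 2))
            ^ (1 / 2 : ℝ)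
          / (K : ℝ) ^ (1 / (2 * (Dep : ℝ) * ((maxWidth l : ℝ) + 1) ^ 2))
        + 3 * max 1 (v - u) * ((maxWidth l : ℝ) + 1)
            * (Dep * max p (2 * Real.log (3 * M * B * c))) ^ (1 / 2 : ℝ)
          / (M : ℝ) ^ (1 / 4 : ℝ)
      ≤ 6 * d * c ^ 2 / (minDepthWidth l : ℝ) ^ (1 / (d : ℝ))
        + 2 * Dep * ((maxWidth l : ℝ) + 1) ^ Dep * c ^ (Dep + 1) * max 1 p
          / (K : ℝ) ^ (1 / (2 * (Dep : ℝ) * ((maxWidth l : ℝ) + 1) ^ 2))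
        + 5 * B ^ 2 * Dep * ((maxWidth l : ℝ) + 1) * max p (Real.log (Real.exp 1 * M))
          / (M : ℝ) ^ (1 / 4 : ℝ) := by
  have hcs := hc
  simp only [max_le_iff] at hcs
  obtain ⟨hc1, hLc, hac, hbc, huc, hvc⟩ := hcs
  have hL : 0 ≤ L := nonneg_of_lipschitz_cube hd hab hELip
  have hB1 : 1 ≤ B := hc1.trans hB
  have h1M : (1 : ℕ) ∈ Set.Icc 1 M := ⟨le_rfl, hM⟩
  have h1K : (1 : ℕ) ∈ Set.Icc 1 K := ⟨le_rfl, hK⟩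
  have hX1 := hX 1 h1M
  have hY1 := hY 1 h1M
  set net : (Fin D → ℝ) → (Fin d → ℝ) → ℝ := fun θ x => clippedNetReal l hl0 hlDep u v θ x with hnet
  have hmem : ∀ θ x, net θ x ∈ Set.Icc u v := fun θ x =>
    clippedNetReal_mem hDep hl0 hlDep huv.le θ x
  have hnetc : Continuous fun q : (Fin D → ℝ) × (Fin d → ℝ) => net q.1 q.2 :=
    continuous_clippedNetReal hl0 hlDep u v
  have hEc : Continuous fun x : Cube d a b => (E x : ℝ) := continuous_of_lipschitz_cube hELip
  have hlossc : Continuous fun q : (Fin D → ℝ) × Cube d a b => |net q.1 q.2 - (E q.2 : ℝ)| ^ 2 :=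
    ((hnetc.comp (continuous_fst.prodMk (continuous_subtype_val.comp continuous_snd))).sub
      (hEc.comp continuous_snd)).abs.pow 2
  have hlossm : ∀ θ, Measurable fun x : Cube d a b => |net θ x - (E x : ℝ)| ^ 2 := fun θ =>
    (hlossc.comp (continuous_const.prodMk continuous_id)).measurable
  have hloss : ∀ θ (x : Cube d a b), |net θ x - (E x : ℝ)| ^ 2 ∈ Set.Icc 0 ((v - u) ^ 2) :=
    fun θ x => sq_loss_mem (hmem θ x) (E x).2
  have : IsProbabilityMeasure (P.map (X 1)) := Measure.isProbabilityMeasure_map hX1.aemeasurable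
  have hinner : ∀ θ, Integrable (fun x : Cube d a b => |net θ x - (E x : ℝ)| ^ 2) (P.map (X 1)) :=
    fun θ => Integrable.of_mem_Icc _ _ (hlossm θ).aemeasurable
      (Filter.Eventually.of_forall fun x => hloss θ x)
  set Z : Ω → Fin D → ℝ := fun ω => Θ (κ ω).1 (κ ω).2 ω with hZ
  have hZm : Measurable Z := by
    -- The index pair ranges over a countable set, so measurability for each fixed pair suffices.
    have h : Measurable fun r : (ℕ × ℕ) × Ω => Θ r.1.1 r.1.2 r.2 :=
      measurable_from_prod_countable_right fun r => hΘ r.1 r.2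
    exact h.comp (hκ.prodMk measurable_id)
  set Q : Ω → ℝ := fun ω => ∫ x : Cube d a b, |net (Z ω) x - (E x : ℝ)| ^ 2 ∂(P.map (X 1)) with hQ
  have hQm : Measurable Q := by
    have h : StronglyMeasurable fun r : Ω × Cube d a b => |net (Z r.1) r.2 - (E r.2 : ℝ)| ^ 2 :=
      (hlossc.measurable.comp ((hZm.comp measurable_fst).prodMk measurable_snd)).stronglyMeasurable
    exact h.integral_prod_right'.measurable
  have hQ0 : ∀ ω, 0 ≤ Q ω := fun ω => integral_nonneg fun x => (hloss _ x).1
  have hQle : ∀ ω, Q ω ≤ (v - u) ^ 2 := fun ω => by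
    calc Q ω ≤ ∫ _x : Cube d a b, (v - u) ^ 2 ∂(P.map (X 1)) :=
          integral_mono (hinner _) (integrable_const _) fun x => (hloss _ x).2
      _ = _ := by simp
  have hQint : Integrable (fun ω => Q ω ^ (p / 2)) P :=
    integrable_of_abs_le (hQm.pow_const _) (C := ((v - u) ^ 2) ^ (p / 2)) fun ω => by
      rw [abs_of_nonneg (Real.rpow_nonneg (hQ0 ω) _)]
      exact Real.rpow_le_rpow (hQ0 ω) (hQle ω) (by positivity)
  refine ⟨fun ω => hinner _, hQint, ?_,
    error_bound_simplified hDep hM hK (Nat.cast_nonneg _) (Nat.cast_nonneg _) hab hc hB⟩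
  set q : ℝ := max 1 (p / 2) with hq
  have hq1 : 1 ≤ q := le_max_left _ _
  obtain ⟨ϑ, hϑ, hϑe⟩ := exists_clippedNetReal_near hd hDep hab hc1 hLc hac hbc huc hvc hL l hl
    hl0 hlDep hDl E hELip
  set e : ℝ := 3 * d * L * (b - a) / (minDepthWidth l : ℝ) ^ (1 / (d : ℝ)) with he
  have he0 : 0 ≤ e := by
    have : 0 ≤ b - a := by linarith
    positivity
  obtain ⟨G, r, τ, hGm, hr, hτ, hGdev, hGn, hrτ⟩ := exists_generalization_bound (D := D) hDep hM huv
    hc1 hac hbc hB hl hl0 hlDep P hX hY hXYindep hXYident hq1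
  have hunif : ∀ k : Set.Icc 1 K, pdf.IsUniform (Θ k 0) (Cube D (-c) c) P volume := fun k => by
    rw [pdf.IsUniform, (hΘident k k.2).map_eq]
    exact hΘunif
  have hn1 : 1 ≤ numParams l := by
    have := layerOffset_add_le l ⟨0, hDep⟩
    have h2 := Nat.mul_le_mul (hl (⟨0, hDep⟩ : Fin Dep).succ)
      (Nat.le_add_left 1 (l (⟨0, hDep⟩ : Fin Dep).castSucc))
    omega
  have : Nonempty (Set.Icc 1 K) := ⟨⟨1, h1K⟩⟩
  set ρ : Ω → ℝ := fun ω => ⨅ k : Set.Icc 1 K,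
    ‖fun i : Fin (numParams l) => paramAt (Θ k 0 ω) i - paramAt ϑ i‖ with hρ
  obtain ⟨hρm, hρn⟩ := eLpNorm_iInf_dist_le P (by linarith : 0 < c)
    (Z := fun k : Set.Icc 1 K => Θ k 0) (fun k => hΘ k 0) hΘindep hunif ϑ hϑ hDl hn1 hq1
  rw [show Fintype.card (Set.Icc 1 K) = K by simp] at hρn
  set w : ℝ := (maxWidth l : ℝ) with hw
  have hw0 : 0 ≤ w := Nat.cast_nonneg _
  have huv' : 0 ≤ v - u := by linarith
  set Λ : ℝ := Dep * c * (w + 1) ^ Dep * c ^ (Dep - 1) with hΛ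
  have hXc : ∀ x : Cube d a b, ∀ j, |(x : Fin d → ℝ) j| ≤ c := fun x j =>
    (abs_le_max_abs_abs (x.2.1 j) (x.2.2 j)).trans (max_le hac hbc)
  have hϑc : ∀ i, |ϑ i| ≤ c := fun i => abs_le.2 ⟨hϑ.1 i, hϑ.2 i⟩
  set risk : (Fin D → ℝ) → ℝ := fun θ => ∫ ω, |net θ (X 1 ω) - (Y 1 ω : ℝ)| ^ 2 ∂P with hrisk
  have hbias : ∀ θ, ∫ x : Cube d a b, |net θ x - (E x : ℝ)| ^ 2 ∂(P.map (X 1)) =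
      risk θ - ∫ ω, |(E (X 1 ω) : ℝ) - (Y 1 ω : ℝ)| ^ 2 ∂P := fun θ => by
    rw [integral_map hX1.aemeasurable (hlossm θ).aestronglyMeasurable]
    have habs : ∀ y ∈ Set.Icc u v, |y| ≤ c := fun y hy => by
      have := abs_le_max_abs_abs hy.1 hy.2
      rcases le_max_iff.1 this with h | h <;> linarith [abs_nonneg u, abs_nonneg v]
    exact integral_sq_sub_regression P hX1 (measurable_subtype_coe.comp hY1)
      (g := fun x : Cube d a b => net θ x) (E := fun x => (E x : ℝ))
      (hnetc.comp (continuous_const.prodMk continuous_subtype_val)).measurable hEc.measurable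
      (fun ω => habs _ (Y 1 ω).2) (fun x => habs _ (hmem θ x)) (fun x => habs _ (E x).2) hE
  have hϑe2 : ∫ x : Cube d a b, |net ϑ x - (E x : ℝ)| ^ 2 ∂(P.map (X 1)) ≤ e ^ 2 := by
    calc _ ≤ ∫ _x : Cube d a b, e ^ 2 ∂(P.map (X 1)) :=
          integral_mono (hinner _) (integrable_const _) fun x => by
            have := hϑe x
            simp only
            gcongr
      _ = _ := by simp
  have hae : ∀ᵐ ω ∂P, ∀ k : Set.Icc 1 K, Θ k 0 ω ∈ Cube D (-c) c :=
    ae_all_iff.2 fun k => ae_mem_of_isUniform measurableSet_Icc (hΘ k 0) (hunif k)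
  -- In turn: true to empirical risk at `Z` (`h1`), minimality (`hopt`), Lipschitz comparison of the
  -- nearest initialization with `ϑ` (`hsearch`), empirical to true risk at `ϑ` (`h2`). The risk of
  -- `E` cancels by `hbias`.
  have hpoint : ∀ᵐ ω ∂P, Q ω ≤ e ^ 2 + 2 * (v - u) * Λ * ρ ω + 2 * (G ω + τ) := by
    filter_upwards [hae] with ω hω
    obtain ⟨k, hk⟩ := exists_eq_ciInf_of_finite (f := fun k : Set.Icc 1 K =>
      ‖fun i : Fin (numParams l) => paramAt (Θ k 0 ω) i - paramAt ϑ i‖)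
    have hkρ : ‖fun i : Fin (numParams l) => paramAt (Θ k 0 ω) i - paramAt ϑ i‖ = ρ ω := hk
    have hopt : R (Z ω) ω ≤ R (Θ k 0 ω) ω := by
      refine hκmin ω (a := ((k : ℕ), 0)) ⟨k.2, hS0, ?_⟩
      refine (pi_norm_le_iff_of_nonneg (by linarith)).2 fun i => ?_
      have := hΘB k k.2.1 ω
      exact abs_le.2 ⟨this.1 i, this.2 i⟩
    have hsearch : R (Θ k 0 ω) ω ≤ R ϑ ω + 2 * (v - u) * Λ * ρ ω := by
      rw [hR, hR, ← sub_le_iff_le_add', ← mul_sub, ← Finset.sum_sub_distrib]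
      have hM' : (0 : ℝ) < M := by exact_mod_cast hM
      calc _ ≤ 1 / (M : ℝ) * ∑ _j ∈ Finset.Icc 1 M, 2 * (v - u) * Λ * ρ ω := by
            gcongr with j hj
            refine (le_abs_self _).trans ((abs_sq_loss_sub_le (hmem _ _) (hmem _ _)
              (Y j ω).2).trans ?_)
            have := abs_clippedNetReal_sub_le (u := u) (v := v) (δ := ρ ω) hl0 hlDep hc1 hc1
              (hkρ ▸ norm_nonneg _)
              (fun i => abs_le.2 ⟨(hω k).1 i, (hω k).2 i⟩) hϑc
              (fun i hi => hkρ ▸ norm_le_pi_norm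
                (fun i : Fin (numParams l) => paramAt (Θ k 0 ω) i - paramAt ϑ i) ⟨i, hi⟩)
              (hXc (X j ω))
            rw [mul_assoc (2 * (v - u))]
            gcongr
        _ = _ := by
            rw [Finset.sum_const, Nat.card_Icc, Nat.add_sub_cancel, nsmul_eq_mul]
            field_simp
    have hZB : ∀ i, |Z ω i| ≤ B := fun i => (norm_le_pi_norm (Z ω) i).trans (hκmem ω).2.2
    have h1 := hGdev (Z ω) hZB ω
    have h2 := hGdev ϑ (fun i => (hϑc i).trans hB) ω
    rw [← hR] at h1 h2
    have h3 := hbias (Z ω)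
    have h4 := hbias ϑ
    have h5 := (abs_le.1 h1).1
    have h6 := (abs_le.1 h2).2
    simp only [hQ]
    linarith
  have hΛ0 : 0 ≤ Λ := by positivity
  have hfinal := integral_rpow_le_of_error_decomposition P hQm hρm hGm hQ0 he0
    (mul_nonneg (mul_nonneg zero_le_two huv') hΛ0) hτ
    (by positivity : 0 ≤ 2 * c * q * (K : ℝ) ^ (-(1 / (numParams l : ℝ)))) hr hpoint hp hq1
    (le_max_right _ _) hρn hGn hQint
  refine hfinal.trans ?_
  have hcpow : c * c ^ (Dep - 1) * c = c ^ (Dep + 1) := by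
    obtain ⟨N, rfl⟩ : ∃ N, Dep = N + 1 := ⟨Dep - 1, by omega⟩
    rw [Nat.add_sub_cancel]; ring
  have hopt_eq : 2 * (v - u) * Λ * (2 * c * q * (K : ℝ) ^ (-(1 / (numParams l : ℝ)))) =
      4 * ((v - u) * Dep * (w + 1) ^ Dep * c ^ (Dep + 1) * q) *
        (K : ℝ) ^ (-(1 / (numParams l : ℝ))) := by
    rw [hΛ, ← hcpow]; ring
  -- Here `2 * q = max 2 p`, and the 2 is redundant because `log (3 * M * B * c) ≥ 1`.
  have hmax : max (2 * q) (2 * Real.log (3 * M * B * c)) =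
      max p (2 * Real.log (3 * M * B * c)) := by
    have hMBc : 1 ≤ M * B * c := one_le_mul_of_one_le_of_one_le
      (one_le_mul_of_one_le_of_one_le (by exact_mod_cast hM) hB1) hc1
    have hlog := one_le_log_three_mul hMBc
    rw [← mul_assoc, ← mul_assoc] at hlog
    have h2q : 2 * q = max 2 p := by
      rw [hq, mul_max_of_nonneg _ _ zero_le_two]; congr 1 <;> ring
    rw [h2q, max_comm 2 p, max_assoc, max_eq_right (by linarith : 2 ≤ 2 * Real.log (3 * M * B * c))]
  have hnw : (numParams l : ℝ) ≤ Dep * (w + 1) ^ 2 := by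
    have : (numParams l : ℝ) ≤ Dep * (w * (w + 1)) := by rw [hw]; exact_mod_cast numParams_le l
    refine this.trans ?_
    gcongr
    nlinarith
  have hgen := Real.sqrt_le_sqrt hrτ
  rw [sqrt_sq_mul_div_sqrt (by positivity) (Nat.cast_nonneg _), hmax] at hgen
  rw [hopt_eq]
  have hrate := optimization_rate_le (Dep := Dep) hK hn1 hw0 hDep hnw
    (by positivity : 0 ≤ (v - u) * Dep * (w + 1) ^ Dep * c ^ (Dep + 1) * q)
  gcongr
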